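/- Let $T\in(0,\infty)$, $a\in\mathbb R$, $b\in\mathbb R\cup\{\infty\}$, $D=(a,b)$, and for $N\in\mathbb N=\{1,2,\dots\}$ let $D_N=(a+1/N,\,b-1/N)$, where $\infty-1/N=\infty$. Let $B$ be a standard Brownian motion with respect to the filtration $(\mathcal F_t)_{t\ge 0}$ of a filtered probability space satisfying the usual conditions. Let $x_0\in D_1$ (in particular $b-a>2$), and let $f,g:\mathbb R\to\mathbb R$ be Lipschitz continuous on $D$ with Lipschitz constants $L_f$ and $L_g$. For $\Delta t>0$ put $\ell_{\Delta t}(s)=k\Delta t$ for $s\in[k\Delta t,(k+1)\Delta t)$, $k=0,1,2,\dots$ An Artificial Barriers Euler--Peano (ABEP) scheme with parameters $N$ and $\Delta t$ is an adapted process $\hat\xi=\hat\xi^{\mathrm{ABEP}}_{N,\Delta t}$ on $[0,T]$ for which there are adapted processes $\hat U,\hat L$ such that, almost surely, $\hat\xi,\hat U,\hat L$ are continuous on $[0,T]$ and $$\hat\xi(t)=x_0+\int_0^t f\big(\hat\xi(\ell_{\Delta t}(s))\big)\,ds+\int_0^t g\big(\hat\xi(\ell_{\Delta t}(s))\big)\,dB(s)-\hat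 U(t)+\hat L(t)\qquad\text{for all } t\in[0,T],$$ with reflection at the boundary of $D_N$: $\hat\xi(t)\in\operatorname{cl}D_N$ for all $t\in[0,T]$, $\hat U$ and $\hat L$ are non-decreasing with $\hat U(0)=\hat L(0)=0$, and $$\int_0^T \mathbf 1_{\{\hat\xi(s)<b-1/N\}}\,d\hat U(s)=0=\int_0^T \mathbf 1_{\{\hat\xi(s)>a+1/N\}}\,d\hat L(s)$$ (so $\hat U\equiv 0$ if $b=\infty$). Theorem. For all $N\in\mathbb N$ and $\Delta t>0$ an ABEP scheme exists, and every ABEP scheme satisfies $$\mathbb P\left(\hat\xi^{\mathrm{ABEP}}_{N,\Delta t}(t)\in\operatorname{cl}D_N,\ \forall t\in[0,T]\right)=1$$ and, for every real $p\ge 2$, $$\mathbb E\left[\sup_{t\in[0,T]}\left|\hat\xi^{\mathrm{ABEP}}_{N,\Delta t}(t)\right|^p\right]\le\begin{cases} C, & \text{if } b=\infty,\\ \max(|a|^p,|b|^p), & \text{if } b<\infty.\end{cases}$$ Here the constant $C$ depends only on $p,T,L_f,L_g,a,x_0$ and on upper bounds for $|f(x_0)|$ and $|g(x_0)|$; in particular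 it does not depend on $N$ and $\Delta t$. (The theorem does not require the boundary points $a,b$ to be unattainable for the SDE $dX=f(X)\,dt+g(X)\,dB$, $X(0)=x_0$, so it covers in particular the case in which they are.) -/

import Mathlib

open MeasureTheory ProbabilityTheory
open scoped NNReal ENNReal

universe u

namespace ABEP

/-- The open interval `(α, β)` with real left endpoint and right endpoint in `ℝ ∪ {∞}`. -/
def openInterval (α : ℝ) (β : WithTop ℝ) : Set ℝ :=
  {x : ℝ | α < x ∧ (x : WithTop ℝ) < β}

/-- The lower artificial barrier `a + 1/N`. -/
noncomputable def lowerBarrier (a : ℝ) (N : ℕ) : ℝ := a + 1 / (N : ℝ)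

/-- The upper artificial barrier `b - 1/N`, with `∞ - 1/N = ∞`. -/
noncomputable def upperBarrier (b : WithTop ℝ) (N : ℕ) : WithTop ℝ :=
  b.map (fun x : ℝ => x - 1 / (N : ℝ))

/-- The domain `D_N = (a + 1/N, b - 1/N)`. -/
noncomputable def domainN (a : ℝ) (b : WithTop ℝ) (N : ℕ) : Set ℝ :=
  openInterval (lowerBarrier a N) (upperBarrier b N)

/-- `ℱ` contains all null sets from time zero on and is right continuous. -/
structure UsualConditions {Ω : Type*} {mΩ : MeasurableSpace Ω}
    (ℱ : Filtration ℝ≥0 mΩ) (P : Measure Ω) : Prop where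
  rightContinuous : ℱ.IsRightContinuous
  complete : ∀ s : Set Ω, P s = 0 → MeasurableSet[ℱ 0] s

/-- `B` is a standard Brownian motion relative to the filtration `ℱ`. -/
structure IsFilteredBrownian {Ω : Type*} {mΩ : MeasurableSpace Ω}
    (B : ℝ≥0 → Ω → ℝ) (ℱ : Filtration ℝ≥0 mΩ) (P : Measure Ω) : Prop where
  isBrownian : IsBrownianReal B P
  adapted : StronglyAdapted ℱ B
  indep : ∀ s t : ℝ≥0, s ≤ t →
    Indep (MeasurableSpace.comap (fun ω => B t ω - B s ω) inferInstance) (ℱ s) P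

/-- `ℓ_Δ(s) = kΔ` for `s ∈ [kΔ, (k+1)Δ)`. -/
noncomputable def gridFloor (Δ s : ℝ≥0) : ℝ≥0 := (⌊s / Δ⌋₊ : ℝ≥0) * Δ

/-- The Itô integral `∫₀ᵗ H(ℓ_Δ(s)) dB(s)` of a process that is constant on each `[kΔ, (k+1)Δ)`,
that is `∑ₖ H(kΔ) (B(min((k+1)Δ, t)) - B(kΔ))`, the sum being over all `k` with `kΔ ≤ t`. -/
noncomputable def stepItoIntegral {Ω : Type*} (Δ : ℝ≥0) (H B : ℝ≥0 → Ω → ℝ)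
    (t : ℝ≥0) (ω : Ω) : ℝ :=
  ∑ k ∈ Finset.range (⌊t / Δ⌋₊ + 1),
    H ((k : ℝ≥0) * Δ) ω * (B (min (((k : ℝ≥0) + 1) * Δ) t) ω - B ((k : ℝ≥0) * Δ) ω)

/-- The unreflected process
`w(t) = x₀ + ∫₀ᵗ f(ξ(ℓ_Δ(s))) ds + ∫₀ᵗ g(ξ(ℓ_Δ(s))) dB(s)`. -/
noncomputable def driver {Ω : Type*} (f g : ℝ → ℝ) (x₀ : ℝ) (Δ : ℝ≥0)
    (B ξ : ℝ≥0 → Ω → ℝ) (t : ℝ≥0) (ω : Ω) : ℝ :=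
  x₀ + (∫ s in (0 : ℝ)..(t : ℝ), f (ξ (gridFloor Δ s.toNNReal) ω))
    + stepItoIntegral Δ (fun s ω' => g (ξ s ω')) B t ω

theorem monotone_stopped {T : ℝ≥0} {u : ℝ≥0 → ℝ} (hu : MonotoneOn u (Set.Iic T)) :
    Monotone (fun s : ℝ≥0 => u (min s T)) := fun _ _ hst =>
  hu (Set.mem_Iic.2 (min_le_right _ _)) (Set.mem_Iic.2 (min_le_right _ _)) (min_le_min_right T hst)

/-- The Lebesgue–Stieltjes measure `du` on `[0, T]` of a path `u` that is non-decreasing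
on `[0, T]` (it gives no mass to `{0}` and to `(T, ∞)`). -/
noncomputable def pathMeasure (T : ℝ≥0) (u : ℝ≥0 → ℝ) (hu : MonotoneOn u (Set.Iic T)) :
    Measure ℝ≥0 :=
  (monotone_stopped hu).stieltjesFunction.measure

/-- On `[0, T]`, the path `x = w - u + l` is the path `w` reflected at `α` and at `β`
(at `α` only, if `β = ∞`), and `u` and `l` are the upper and the lower barrier term. -/
structure IsReflectedPath (T : ℝ≥0) (α : ℝ) (β : WithTop ℝ) (w x u l : ℝ≥0 → ℝ) : Prop where
  mem : ∀ t ≤ T, x t ∈ closure (openInterval α β)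
  continuousOn : ContinuousOn x (Set.Iic T)
  continuousOn_upper : ContinuousOn u (Set.Iic T)
  continuousOn_lower : ContinuousOn l (Set.Iic T)
  upper_zero : u 0 = 0
  lower_zero : l 0 = 0
  upper_mono : MonotoneOn u (Set.Iic T)
  lower_mono : MonotoneOn l (Set.Iic T)
  /-- `∫₀ᵀ 1_{x(s) < β} du(s) = 0` -/
  upper_flat : pathMeasure T u upper_mono {s | s ≤ T ∧ (x s : WithTop ℝ) < β} = 0
  /-- `∫₀ᵀ 1_{x(s) > α} dl(s) = 0` -/
  lower_flat : pathMeasure T l lower_mono {s | s ≤ T ∧ α < x s} = 0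
  eq : ∀ t ≤ T, x t = w t - u t + l t

/-- `ξ`, with upper barrier process `U` and lower barrier process `L`, is the Artificial Barriers
Euler–Peano scheme on `[0, T]`: the adapted solution of the reflected equation
`dξ(t) = f(ξ(ℓ_Δ(t))) dt + g(ξ(ℓ_Δ(t))) dB(t) - dU(t) + dL(t)`, `ξ(0) = x₀`,
with reflection at `a + 1/N` and at `b - 1/N`. -/
structure IsScheme {Ω : Type*} {mΩ : MeasurableSpace Ω} (P : Measure Ω)
    (ℱ : Filtration ℝ≥0 mΩ) (B : ℝ≥0 → Ω → ℝ) (T : ℝ≥0) (f g : ℝ → ℝ) (x₀ a : ℝ)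
    (b : WithTop ℝ) (N : ℕ) (Δ : ℝ≥0) (ξ U L : ℝ≥0 → Ω → ℝ) : Prop where
  adapted : ∀ t ≤ T, StronglyMeasurable[ℱ t] (ξ t)
  adapted_upper : ∀ t ≤ T, StronglyMeasurable[ℱ t] (U t)
  adapted_lower : ∀ t ≤ T, StronglyMeasurable[ℱ t] (L t)
  reflected : ∀ᵐ ω ∂P, IsReflectedPath T (lowerBarrier a N) (upperBarrier b N)
    (fun t => driver f g x₀ Δ B ξ t ω) (fun t => ξ t ω) (fun t => U t ω) (fun t => L t ω)

/-- `E[sup_{t ∈ [0, T]} |ξ(t)|^p]`, with values in `[0, ∞]`. -/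
noncomputable def supMoment {Ω : Type*} {mΩ : MeasurableSpace Ω} (P : Measure Ω)
    (T : ℝ≥0) (p : ℝ) (ξ : ℝ≥0 → Ω → ℝ) : ℝ≥0∞ :=
  ∫⁻ ω, ⨆ t ∈ Set.Iic T, ENNReal.ofReal (|ξ t ω| ^ p) ∂P

end ABEP

namespace ABEP

/-! The scheme is explicit in time: the driver `w` up to time t involves ξ only through its values
at grid points strictly before t. Existence therefore reduces to a pathwise statement, the Skorokhod
problem for a continuous path, and Picard iteration becomes exact on [0, T] after finitely many
steps (`picard_succ_eq`).

With one barrier the reflection term is the running supremum of (α - w)⁺. With two, alternating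
running suprema (`lowerIter`, `upperIter`) increase to the smallest pair of non-decreasing,
non-negative terms that keeps w - U + L in [α, β]. Some such pair exists by polynomial approximation
of w (`exists_isBarrierPair`), so the limits are finite. Minimality yields their continuity
(`lim_sub_le`), and the fixed point equations `upperLim_eq_runSup` and `lowerLim_eq_runSup` show
that each term grows only at its own barrier, because a running supremum does not grow while the
path is strictly below it (`pathMeasure_runSup_null`). Running suprema look only at the past and are
determined by countably many times, which gives adaptedness.

For b < ∞ the moment bound is confinement. For b = ∞, flatness of the lower term gives |ξ(t)| ≤ |x₀|
+ 2 sup |w - x₀| for every scheme (`IsReflectedPath.abs_path_le`); the barrier enters only through α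
≤ x₀, so N disappears. Doob's inequality (`lintegral_iSup_abs_pow_le`) handles the supremum of the
martingale part, and over one step the moments of both parts grow by a multiple of the step length
(`integral_elemInt_succ_le`, `integral_driftSum_succ_le`). Linear growth of the coefficients closes
a discrete Gronwall argument (`lintegral_iSup_abs_pow_le_exp`), whose exponential bound does not see
Δ. The coefficients, Lipschitz only on D, are replaced by Lipschitz extensions that agree with them
on cl D_N. -/

/-! ### Step integrals as finite grid sums -/

/-- The integral up to time `t` of the step function with value `c k` on `[kΔ, (k+1)Δ)`, `k < K`,
against the path `A`. -/
noncomputable def gridSum (Δ : ℝ≥0) (K : ℕ) (c : ℕ → ℝ) (A : ℝ≥0 → ℝ) (t : ℝ≥0) : ℝ :=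
  ∑ k ∈ Finset.range K, c k * (A (min (((k + 1 : ℕ) : ℝ≥0) * Δ) t) - A (min ((k : ℝ≥0) * Δ) t))

/-- A step beginning at or after t has both endpoints clipped to t and contributes nothing. One
number of steps thus serves a whole bounded range of times, and continuity in t becomes that of a
finite sum. -/
theorem gridSum_eq_of_le {Δ t : ℝ≥0} {K K' : ℕ} (c : ℕ → ℝ) (A : ℝ≥0 → ℝ) (ht : t ≤ K * Δ)
    (hK : K ≤ K') : gridSum Δ K c A t = gridSum Δ K' c A t := by
  refine Finset.sum_subset (Finset.range_subset_range.2 hK) fun k _ hk => ?_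
  have hk : K ≤ k := by simpa using hk
  have h1 : t ≤ (k : ℝ≥0) * Δ := ht.trans (by gcongr)
  have h2 : t ≤ ((k + 1 : ℕ) : ℝ≥0) * Δ := h1.trans (by gcongr; simp)
  rw [min_eq_right h1, min_eq_right h2, sub_self, mul_zero]

theorem continuous_gridSum (Δ : ℝ≥0) (K : ℕ) (c : ℕ → ℝ) {A : ℝ≥0 → ℝ} (hA : Continuous A) :
    Continuous (gridSum Δ K c A) := by
  unfold gridSum
  fun_prop

@[simp]
theorem gridSum_zero (Δ : ℝ≥0) (K : ℕ) (c : ℕ → ℝ) (A : ℝ≥0 → ℝ) : gridSum Δ K c A 0 = 0 := by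
  simp [gridSum]

theorem le_floor_succ_mul {Δ : ℝ≥0} (hΔ : 0 < Δ) (t : ℝ≥0) :
    t ≤ ((⌊t / Δ⌋₊ + 1 : ℕ) : ℝ≥0) * Δ := by
  have := (Nat.lt_floor_add_one (t / Δ)).le
  rw [div_le_iff₀ hΔ] at this
  simpa using this

theorem stepItoIntegral_eq_gridSum {Ω : Type*} {Δ t : ℝ≥0} (hΔ : 0 < Δ) {K : ℕ} (ht : t ≤ K * Δ)
    (H B : ℝ≥0 → Ω → ℝ) (ω : Ω) :
    stepItoIntegral Δ H B t ω
      = gridSum Δ K (fun k => H ((k : ℝ≥0) * Δ) ω) (fun s => B s ω) t := by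
  have h1 : stepItoIntegral Δ H B t ω = gridSum Δ (⌊t / Δ⌋₊ + 1)
      (fun k => H ((k : ℝ≥0) * Δ) ω) (fun s => B s ω) t := by
    refine Finset.sum_congr rfl fun k hk => ?_
    have hk : (k : ℝ≥0) * Δ ≤ t := by
      rw [← le_div_iff₀ hΔ]
      exact (Nat.cast_le.2 (Nat.lt_succ_iff.1 (Finset.mem_range.1 hk))).trans
        (Nat.floor_le zero_le)
    rw [min_eq_left hk]
    simp
  rw [h1]
  rcases le_total K (⌊t / Δ⌋₊ + 1) with h | h
  · rw [gridSum_eq_of_le _ _ ht h]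
  · rw [gridSum_eq_of_le _ _ (le_floor_succ_mul hΔ t) h]

theorem gridFloor_eq {Δ s : ℝ≥0} (hΔ : 0 < Δ) {k : ℕ} (h1 : (k : ℝ≥0) * Δ ≤ s)
    (h2 : s < ((k + 1 : ℕ) : ℝ≥0) * Δ) : gridFloor Δ s = k * Δ := by
  have : ⌊s / Δ⌋₊ = k := by
    rw [Nat.floor_eq_iff zero_le, le_div_iff₀ hΔ, div_lt_iff₀ hΔ]
    exact ⟨h1, by simpa using h2⟩
  rw [gridFloor, this]

theorem integral_gridFloor_eq_gridSum {Δ t : ℝ≥0} (hΔ : 0 < Δ) {K : ℕ} (ht : t ≤ K * Δ)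
    (h : ℝ≥0 → ℝ) :
    ∫ s in (0 : ℝ)..(t : ℝ), h (gridFloor Δ s.toNNReal)
      = gridSum Δ K (fun k => h ((k : ℝ≥0) * Δ)) (fun s => (s : ℝ)) t := by
  set a : ℕ → ℝ := fun k => ((min ((k : ℝ≥0) * Δ) t : ℝ≥0) : ℝ) with ha
  have ha0 : a 0 = 0 := by simp [ha]
  have haK : a K = t := by
    simp only [ha, min_eq_right ht]
  have hmono : ∀ k, a k ≤ a (k + 1) := fun k => by
    simp only [ha]
    gcongr
    simp
  have heq : ∀ k : ℕ, Set.EqOn (fun s : ℝ => h (gridFloor Δ s.toNNReal))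
      (fun _ => h ((k : ℝ≥0) * Δ)) (Set.Ioo (a k) (a (k + 1))) := by
    intro k s hs
    have hs0 : 0 ≤ s := (NNReal.coe_nonneg _).trans hs.1.le
    lift s to ℝ≥0 using hs0
    simp only [ha, Set.mem_Ioo, NNReal.coe_lt_coe] at hs
    have hst : s < t := hs.2.trans_le (min_le_right _ _)
    have h1 : (k : ℝ≥0) * Δ ≤ s := by
      rcases min_lt_iff.1 hs.1 with h | h
      · exact h.le
      · exact absurd h hst.not_gt
    simp only [Real.toNNReal_coe]
    rw [gridFloor_eq hΔ h1 (hs.2.trans_le (min_le_left _ _))]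
  -- At the right endpoint `gridFloor` may already have jumped; that point is null, so nothing is
  -- asked of `h`.
  have hae : ∀ k : ℕ, (fun s : ℝ => h (gridFloor Δ s.toNNReal))
      =ᵐ[volume.restrict (Set.uIoc (a k) (a (k + 1)))] fun _ => h ((k : ℝ≥0) * Δ) := by
    intro k
    rw [Set.uIoc_of_le (hmono k), ← restrict_Ioo_eq_restrict_Ioc]
    exact (ae_restrict_mem measurableSet_Ioo).mono fun s hs => heq k hs
  rw [← ha0, ← haK, ← intervalIntegral.sum_integral_adjacent_intervals]
  · refine Finset.sum_congr rfl fun k _ => ?_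
    rw [intervalIntegral.integral_congr_ae_restrict (hae k), intervalIntegral.integral_const,
      smul_eq_mul, mul_comm]
  · intro k _
    exact intervalIntegrable_const.congr_ae (hae k).symm

theorem driver_eq {Ω : Type*} {Δ t : ℝ≥0} (hΔ : 0 < Δ) {K : ℕ} (ht : t ≤ K * Δ)
    (f g : ℝ → ℝ) (x₀ : ℝ) (B ξ : ℝ≥0 → Ω → ℝ) (ω : Ω) :
    driver f g x₀ Δ B ξ t ω
      = x₀ + gridSum Δ K (fun k => f (ξ ((k : ℝ≥0) * Δ) ω)) (fun s => (s : ℝ)) t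
        + gridSum Δ K (fun k => g (ξ ((k : ℝ≥0) * Δ) ω)) (fun s => B s ω) t := by
  rw [driver, stepItoIntegral_eq_gridSum hΔ ht,
    integral_gridFloor_eq_gridSum hΔ ht (fun s => f (ξ s ω))]

/-! ### Running suprema and the measures they induce -/

/-- The running maximum `sup_{r ≤ t} max (h r) 0`. -/
noncomputable def runSup (h : ℝ≥0 → ℝ) (t : ℝ≥0) : ℝ :=
  sSup ((fun r => max (h (t * r)) 0) '' Set.Icc 0 1)

theorem runSup_nonneg (h : ℝ≥0 → ℝ) (t : ℝ≥0) : 0 ≤ runSup h t :=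
  Real.sSup_nonneg (by rintro _ ⟨r, _, rfl⟩; exact le_max_right _ _)

theorem runSup_le {h : ℝ≥0 → ℝ} {t : ℝ≥0} {c : ℝ} (hc : 0 ≤ c) (H : ∀ r ≤ t, h r ≤ c) :
    runSup h t ≤ c := by
  refine csSup_le ((Set.nonempty_Icc.2 zero_le_one).image _) ?_
  rintro _ ⟨r, hr, rfl⟩
  exact max_le (H _ (mul_le_of_le_one_right zero_le hr.2)) hc

theorem le_runSup {h : ℝ≥0 → ℝ} (hh : Continuous h) {r t : ℝ≥0} (hr : r ≤ t) :
    h r ≤ runSup h t := by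
  have hb : BddAbove ((fun r => max (h (t * r)) 0) '' Set.Icc 0 1) :=
    isCompact_Icc.bddAbove_image (by fun_prop)
  obtain ⟨q, hq, rfl⟩ : ∃ q ∈ Set.Icc (0 : ℝ≥0) 1, t * q = r := by
    rcases eq_or_ne t 0 with rfl | ht
    · exact ⟨0, by simp, by simpa using hr.antisymm zero_le |>.symm⟩
    · exact ⟨r / t, ⟨zero_le, div_le_one_of_le₀ hr zero_le⟩, mul_div_cancel₀ _ ht⟩
  exact (le_max_left _ _).trans (le_csSup hb ⟨q, hq, rfl⟩)

theorem runSup_mono {h : ℝ≥0 → ℝ} (hh : Continuous h) : Monotone (runSup h) := fun _ _ hst =>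
  runSup_le (runSup_nonneg _ _) fun _ hr => le_runSup hh (hr.trans hst)

theorem runSup_le_runSup {h h' : ℝ≥0 → ℝ} (hh : Continuous h') {t : ℝ≥0}
    (H : ∀ r ≤ t, h r ≤ h' r) : runSup h t ≤ runSup h' t :=
  runSup_le (runSup_nonneg _ _) fun r hr => (H r hr).trans (le_runSup hh hr)

/-- The supremum is over the fixed compact [0, 1], with t only a parameter of the integrand; this is
why the times up to t are written as t * r. -/
theorem continuous_runSup {h : ℝ≥0 → ℝ} (hh : Continuous h) : Continuous (runSup h) :=
  isCompact_Icc.continuous_sSup (f := fun t r : ℝ≥0 => max (h (t * r)) 0)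
    (by simp only [Function.HasUncurry.uncurry, id_eq]; fun_prop)

theorem runSup_congr {h h' : ℝ≥0 → ℝ} {t : ℝ≥0} (H : ∀ r ≤ t, h r = h' r) :
    runSup h t = runSup h' t := by
  unfold runSup
  congr 1
  refine Set.image_congr fun r hr => ?_
  rw [H _ (mul_le_of_le_one_right zero_le hr.2)]

/-- By continuity a dense sequence of times, clipped at t, suffices. This turns sublevel sets of the
running supremum into countable intersections of events known at time t. -/
theorem runSup_le_iff {h : ℝ≥0 → ℝ} (hh : Continuous h) {t : ℝ≥0} {c : ℝ} :
    runSup h t ≤ c ↔ 0 ≤ c ∧ ∀ n, h (min (TopologicalSpace.denseSeq ℝ≥0 n) t) ≤ c := by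
  constructor
  · exact fun H => ⟨(runSup_nonneg _ _).trans H,
      fun n => (le_runSup hh (min_le_right _ _)).trans H⟩
  · rintro ⟨hc, H⟩
    refine runSup_le hc fun r hr => ?_
    have hcl : IsClosed {r | h (min r t) ≤ c} := isClosed_le (by fun_prop) continuous_const
    have := hcl.closure_subset_iff.2 (Set.range_subset_iff.2 H)
    rw [(TopologicalSpace.denseRange_denseSeq ℝ≥0).closure_range] at this
    simpa [min_eq_left hr] using this (Set.mem_univ r)

theorem measurable_runSup {Ω : Type*} {m : MeasurableSpace Ω} {h : ℝ≥0 → Ω → ℝ}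
    (hc : ∀ ω, Continuous fun t => h t ω) {t : ℝ≥0} (hm : ∀ s ≤ t, Measurable (h s)) :
    Measurable fun ω => runSup (fun s => h s ω) t := by
  refine measurable_of_Iic fun c => ?_
  have : (fun ω => runSup (fun s => h s ω) t) ⁻¹' Set.Iic c
      = {_ω | 0 ≤ c} ∩ ⋂ n, {ω | h (min (TopologicalSpace.denseSeq ℝ≥0 n) t) ω ≤ c} := by
    ext ω
    simp [runSup_le_iff (hc ω)]
  rw [this]
  exact (MeasurableSet.const _).inter
    (MeasurableSet.iInter fun n => measurableSet_le (hm _ (min_le_right _ _)) measurable_const)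

theorem continuous_stopped {T : ℝ≥0} {u : ℝ≥0 → ℝ} (hu : ContinuousOn u (Set.Iic T)) :
    Continuous fun s => u (min s T) :=
  hu.comp_continuous (by fun_prop) fun s => min_le_right s T

theorem stieltjesFunction_stopped {T : ℝ≥0} {u : ℝ≥0 → ℝ} (hm : MonotoneOn u (Set.Iic T))
    (hu : ContinuousOn u (Set.Iic T)) (t : ℝ≥0) :
    (monotone_stopped hm).stieltjesFunction t = u (min t T) :=
  (continuous_stopped hu).continuousWithinAt.rightLim_eq

theorem pathMeasure_Ioc {T : ℝ≥0} {u : ℝ≥0 → ℝ} (hm : MonotoneOn u (Set.Iic T))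
    (hu : ContinuousOn u (Set.Iic T)) (c d : ℝ≥0) :
    pathMeasure T u hm (Set.Ioc c d) = ENNReal.ofReal (u (min d T) - u (min c T)) := by
  rw [pathMeasure, StieltjesFunction.measure_Ioc, stieltjesFunction_stopped hm hu,
    stieltjesFunction_stopped hm hu]

theorem pathMeasure_Icc {T : ℝ≥0} {u : ℝ≥0 → ℝ} (hm : MonotoneOn u (Set.Iic T))
    (hu : ContinuousOn u (Set.Iic T)) (c d : ℝ≥0) :
    pathMeasure T u hm (Set.Icc c d) = ENNReal.ofReal (u (min d T) - u (min c T)) := by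
  have h : ⇑(monotone_stopped hm).stieltjesFunction = fun s => u (min s T) :=
    funext (stieltjesFunction_stopped hm hu)
  rw [pathMeasure, StieltjesFunction.measure_Icc, h,
    (continuous_stopped hu).continuousWithinAt.leftLim_eq]

/-- If h < m < `runSup h` near a point, then on a small closed interval no value of h reaches the
level already attained at its left end, so the running supremum is constant there. The set is thus
locally null, hence null. -/
theorem pathMeasure_runSup_null {h : ℝ≥0 → ℝ} (hh : Continuous h) (T : ℝ≥0)
    (hm : MonotoneOn (runSup h) (Set.Iic T)) :
    pathMeasure T (runSup h) hm {s | s ≤ T ∧ h s < runSup h s} = 0 := by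
  refine measure_null_of_locally_null _ ?_
  rintro s ⟨-, hs⟩
  obtain ⟨m, hm1, hm2⟩ := exists_between hs
  have hU := continuous_runSup hh
  obtain ⟨c, d, hcd, hnhd, hsub⟩ := exists_Icc_mem_subset_of_mem_nhds
    (Filter.inter_mem (hh.continuousAt.eventually_lt_const hm1)
      (hU.continuousAt.eventually_const_lt hm2))
  refine ⟨Set.Icc c d, mem_nhdsWithin_of_mem_nhds hnhd, ?_⟩
  rw [pathMeasure_Icc hm hU.continuousOn, ENNReal.ofReal_eq_zero, sub_nonpos]
  refine runSup_le (runSup_nonneg _ _) fun r hr => ?_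
  rcases le_total r (min c T) with h1 | h1
  · exact le_runSup hh h1
  · have hcd' : c ≤ d := hcd.1.trans hcd.2
    rcases le_total c T with hcT | hcT
    · rw [min_eq_left hcT] at h1 ⊢
      exact (hsub ⟨h1, hr.trans (min_le_left _ _)⟩).1.le.trans (hsub ⟨le_rfl, hcd'⟩).2.le
    · rw [min_eq_right hcT]
      exact le_runSup hh (hr.trans (min_le_right _ _))

/-! ### Skorokhod problem between two finite barriers -/

section TwoSided

/-- The increasing approximations of the lower barrier term of the path `w` in `[α, β]`. -/
noncomputable def lowerIter (α β : ℝ) (w : ℝ≥0 → ℝ) : ℕ → ℝ≥0 → ℝ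
  | 0 => fun _ => 0
  | n + 1 => runSup fun r => α - w r + runSup (fun s => w s + lowerIter α β w n s - β) r

/-- The increasing approximations of the upper barrier term of the path `w` in `[α, β]`. -/
noncomputable def upperIter (α β : ℝ) (w : ℝ≥0 → ℝ) (n : ℕ) : ℝ≥0 → ℝ :=
  runSup fun s => w s + lowerIter α β w n s - β

variable {α β : ℝ} {w : ℝ≥0 → ℝ}

theorem lowerIter_succ (n : ℕ) :
    lowerIter α β w (n + 1) = runSup fun r => α - w r + upperIter α β w n r := rfl

theorem continuous_lowerIter (hw : Continuous w) : ∀ n, Continuous (lowerIter α β w n)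
  | 0 => continuous_const
  | n + 1 => by
    have := continuous_lowerIter hw n
    exact continuous_runSup ((continuous_const.sub hw).add (continuous_runSup (by fun_prop)))

theorem continuous_upperIter (hw : Continuous w) (n : ℕ) : Continuous (upperIter α β w n) := by
  have := continuous_lowerIter (α := α) (β := β) hw n
  exact continuous_runSup (by fun_prop)

theorem continuous_upperArg (hw : Continuous w) (n : ℕ) :
    Continuous fun s => w s + lowerIter α β w n s - β := by
  have := continuous_lowerIter (α := α) (β := β) hw n
  fun_prop

theorem continuous_lowerArg (hw : Continuous w) (n : ℕ) :
    Continuous fun s => α - w s + upperIter α β w n s := by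
  have := continuous_upperIter (α := α) (β := β) hw n
  fun_prop

theorem lowerIter_nonneg (n : ℕ) (t : ℝ≥0) : 0 ≤ lowerIter α β w n t := by
  cases n with
  | zero => exact le_rfl
  | succ n => exact runSup_nonneg _ _

theorem upperIter_nonneg (n : ℕ) (t : ℝ≥0) : 0 ≤ upperIter α β w n t := runSup_nonneg _ _

theorem upperIter_le_of_lowerIter_le (hw : Continuous w) {m n : ℕ}
    (h : ∀ t, lowerIter α β w m t ≤ lowerIter α β w n t) (t : ℝ≥0) :
    upperIter α β w m t ≤ upperIter α β w n t :=
  runSup_le_runSup (continuous_upperArg hw n) fun r _ => by linarith [h r]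

theorem lowerIter_le_succ (hw : Continuous w) :
    ∀ n t, lowerIter α β w n t ≤ lowerIter α β w (n + 1) t
  | 0, _ => lowerIter_nonneg _ _
  | n + 1, t => by
    have := upperIter_le_of_lowerIter_le hw (lowerIter_le_succ hw n)
    rw [lowerIter_succ, lowerIter_succ]
    exact runSup_le_runSup (continuous_lowerArg hw _) fun r _ => by linarith [this r]

theorem monotone_lowerIter (hw : Continuous w) (t : ℝ≥0) :
    Monotone fun n => lowerIter α β w n t :=
  monotone_nat_of_le_succ fun n => lowerIter_le_succ hw n t

theorem monotone_upperIter (hw : Continuous w) (t : ℝ≥0) :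
    Monotone fun n => upperIter α β w n t :=
  fun _ _ hmn => upperIter_le_of_lowerIter_le hw (fun s => monotone_lowerIter hw s hmn) t

/-- Non-decreasing non-negative paths `p`, `q` such that `w - p + q` stays in `[α, β]` up to
time `t`. -/
structure IsBarrierPair (α β : ℝ) (w : ℝ≥0 → ℝ) (t : ℝ≥0) (p q : ℝ≥0 → ℝ) : Prop where
  upper_nonneg : ∀ r ≤ t, 0 ≤ p r
  lower_nonneg : ∀ r ≤ t, 0 ≤ q r
  upper_mono : MonotoneOn p (Set.Iic t)
  lower_mono : MonotoneOn q (Set.Iic t)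
  le_add : ∀ r ≤ t, α ≤ w r - p r + q r
  add_le : ∀ r ≤ t, w r - p r + q r ≤ β

theorem IsBarrierPair.upperIter_le_of {t : ℝ≥0} {p q : ℝ≥0 → ℝ} (h : IsBarrierPair α β w t p q)
    {n : ℕ} (hn : ∀ r ≤ t, lowerIter α β w n r ≤ q r) (r : ℝ≥0) (hr : r ≤ t) :
    upperIter α β w n r ≤ p r :=
  runSup_le (h.upper_nonneg r hr) fun s hs => by
    have h1 := hn s (hs.trans hr)
    have h2 := h.add_le s (hs.trans hr)
    have h3 := h.upper_mono (hs.trans hr) hr hs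
    linarith

/-- Each iterate applies only the push that the constraints force on any admissible pair, so
induction keeps it below every such pair. This bounds the iterates and makes their limit minimal. -/
theorem IsBarrierPair.lowerIter_le {t : ℝ≥0} {p q : ℝ≥0 → ℝ} (h : IsBarrierPair α β w t p q) :
    ∀ n, ∀ r ≤ t, lowerIter α β w n r ≤ q r
  | 0, r, hr => h.lower_nonneg r hr
  | n + 1, r, hr => runSup_le (h.lower_nonneg r hr) fun s hs => by
    have h1 : upperIter α β w n s ≤ p s := h.upperIter_le_of (h.lowerIter_le n) s (hs.trans hr)
    have h2 := h.le_add s (hs.trans hr)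
    have h3 := h.lower_mono (hs.trans hr) hr hs
    change α - w s + upperIter α β w n s ≤ q r
    linarith

theorem IsBarrierPair.upperIter_le {t : ℝ≥0} {p q : ℝ≥0 → ℝ} (h : IsBarrierPair α β w t p q)
    (n : ℕ) (r : ℝ≥0) (hr : r ≤ t) : upperIter α β w n r ≤ p r :=
  h.upperIter_le_of (h.lowerIter_le n) r hr

/-- A polynomial P within (β - α)/2 of w - (α + β)/2 keeps w - P inside [α, β]; being Lipschitz on
[0, t], it is a difference of two non-decreasing functions. -/
theorem exists_isBarrierPair (hαβ : α < β) (hw : Continuous w) (t : ℝ≥0) :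
    ∃ p q, IsBarrierPair α β w t p q := by
  obtain ⟨P, hP⟩ := exists_polynomial_near_of_continuousOn 0 t
    (fun s => w s.toNNReal - (α + β) / 2) (by fun_prop) ((β - α) / 2) (by linarith)
  have hsmooth : ContDiff ℝ 1 fun x : ℝ => P.eval x := by
    simpa using P.contDiff_aeval (R := ℝ) (𝕜 := ℝ) 1
  obtain ⟨K, hK⟩ := hsmooth.contDiffOn.exists_lipschitzOnWith one_ne_zero
    (convex_Icc (0 : ℝ) t) isCompact_Icc
  have hlip : ∀ r s : ℝ≥0, r ≤ s → s ≤ t → |P.eval (s : ℝ) - P.eval (r : ℝ)| ≤ K * (s - r) := by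
    intro r s hrs hst
    have := hK.dist_le_mul (s : ℝ) ⟨s.2, hst⟩ (r : ℝ) ⟨r.2, hrs.trans hst⟩
    rwa [Real.dist_eq, Real.dist_eq,
      abs_of_nonneg (a := (s : ℝ) - r) (sub_nonneg.2 (NNReal.coe_le_coe.2 hrs))] at this
  have hmono : ∀ r s : ℝ≥0, r ≤ s → s ≤ t →
      P.eval (r : ℝ) + K * r ≤ P.eval (s : ℝ) + K * s := by
    intro r s hrs hst
    have := (abs_le.1 (hlip r s hrs hst)).1
    linarith
  have hq : Monotone fun r : ℝ≥0 => (K : ℝ) * r + |P.eval 0| := fun r s hrs => by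
    have : (r : ℝ) ≤ s := hrs
    dsimp only
    gcongr
  -- The slope K compensates any decrease of P, and the shift by |P(0)| makes both terms
  -- non-negative; the difference of the two is P.
  refine ⟨fun r => P.eval (r : ℝ) + K * r + |P.eval 0|, fun r => K * r + |P.eval 0|,
    fun r hr => ?_, fun r hr => by positivity, fun r _ s hs hrs => ?_, hq.monotoneOn _,
    fun r hr => ?_, fun r hr => ?_⟩
  · have := hmono 0 r zero_le hr
    simp only [NNReal.coe_zero, mul_zero, add_zero] at this
    linarith [neg_abs_le (P.eval 0)]
  · simpa using hmono r s hrs hs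
  all_goals
    have := abs_lt.1 (hP r ⟨r.2, hr⟩)
    simp only [Real.toNNReal_coe] at this
    linarith

/-- The lower barrier term of the path `w` reflected at `α` and `β`. -/
noncomputable def lowerLim (α β : ℝ) (w : ℝ≥0 → ℝ) (t : ℝ≥0) : ℝ := ⨆ n, lowerIter α β w n t

/-- The upper barrier term of the path `w` reflected at `α` and `β`. -/
noncomputable def upperLim (α β : ℝ) (w : ℝ≥0 → ℝ) (t : ℝ≥0) : ℝ := ⨆ n, upperIter α β w n t

theorem bddAbove_lowerIter (hαβ : α < β) (hw : Continuous w) (t : ℝ≥0) :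
    BddAbove (Set.range fun n => lowerIter α β w n t) := by
  obtain ⟨p, q, h⟩ := exists_isBarrierPair hαβ hw t
  exact ⟨q t, Set.forall_mem_range.2 fun n => h.lowerIter_le n t le_rfl⟩

theorem bddAbove_upperIter (hαβ : α < β) (hw : Continuous w) (t : ℝ≥0) :
    BddAbove (Set.range fun n => upperIter α β w n t) := by
  obtain ⟨p, q, h⟩ := exists_isBarrierPair hαβ hw t
  exact ⟨p t, Set.forall_mem_range.2 fun n => h.upperIter_le n t le_rfl⟩

theorem tendsto_lowerIter (hαβ : α < β) (hw : Continuous w) (t : ℝ≥0) :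
    Filter.Tendsto (fun n => lowerIter α β w n t) Filter.atTop (nhds (lowerLim α β w t)) :=
  tendsto_atTop_ciSup (monotone_lowerIter hw t) (bddAbove_lowerIter hαβ hw t)

theorem tendsto_upperIter (hαβ : α < β) (hw : Continuous w) (t : ℝ≥0) :
    Filter.Tendsto (fun n => upperIter α β w n t) Filter.atTop (nhds (upperLim α β w t)) :=
  tendsto_atTop_ciSup (monotone_upperIter hw t) (bddAbove_upperIter hαβ hw t)

theorem IsBarrierPair.lowerLim_le {t : ℝ≥0} {p q : ℝ≥0 → ℝ} (h : IsBarrierPair α β w t p q) :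
    lowerLim α β w t ≤ q t :=
  ciSup_le fun n => h.lowerIter_le n t le_rfl

theorem IsBarrierPair.upperLim_le {t : ℝ≥0} {p q : ℝ≥0 → ℝ} (h : IsBarrierPair α β w t p q) :
    upperLim α β w t ≤ p t :=
  ciSup_le fun n => h.upperIter_le n t le_rfl

theorem isBarrierPair_lim (hαβ : α < β) (hw : Continuous w) (t : ℝ≥0) :
    IsBarrierPair α β w t (upperLim α β w) (lowerLim α β w) where
  upper_nonneg r _ := Real.iSup_nonneg fun n => upperIter_nonneg n r
  lower_nonneg r _ := Real.iSup_nonneg fun n => lowerIter_nonneg n r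
  upper_mono r _ s _ hrs := le_of_tendsto_of_tendsto' (tendsto_upperIter hαβ hw r)
    (tendsto_upperIter hαβ hw s) fun n => runSup_mono (continuous_upperArg hw n) hrs
  lower_mono r _ s _ hrs := le_of_tendsto_of_tendsto'
    ((Filter.tendsto_add_atTop_iff_nat 1).2 (tendsto_lowerIter hαβ hw r))
    ((Filter.tendsto_add_atTop_iff_nat 1).2 (tendsto_lowerIter hαβ hw s))
    fun n => runSup_mono (continuous_lowerArg hw n) hrs
  le_add r _ := by
    have := le_of_tendsto_of_tendsto' ((tendsto_upperIter hαβ hw r).const_add (α - w r))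
      ((Filter.tendsto_add_atTop_iff_nat 1).2 (tendsto_lowerIter hαβ hw r))
      fun n => le_runSup (continuous_lowerArg hw n) le_rfl
    linarith
  add_le r _ := by
    have := le_of_tendsto_of_tendsto'
      (((tendsto_lowerIter hαβ hw r).const_add (w r)).sub_const β)
      (tendsto_upperIter hαβ hw r)
      fun n => le_runSup (continuous_upperArg hw n) le_rfl
    linarith

/-- On an interval on which `w` oscillates by at most `η`, the barrier terms grow by at
most `η`. -/
theorem lim_sub_le (hαβ : α < β) (hw : Continuous w) {s t : ℝ≥0} (hst : s ≤ t) {η : ℝ}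
    (hη : 2 * η ≤ β - α) (hosc : ∀ r, s ≤ r → r ≤ t → |w r - w s| ≤ η) :
    upperLim α β w t ≤ upperLim α β w s + η ∧ lowerLim α β w t ≤ lowerLim α β w s + η := by
  rcases hst.eq_or_lt with rfl | hst'
  · have : 0 ≤ η := (abs_nonneg _).trans (hosc s le_rfl le_rfl)
    constructor <;> linarith
  have H := isBarrierPair_lim hαβ hw s
  set U := upperLim α β w
  set L := lowerLim α β w
  set x := w s - U s + L s with hx
  have hx1 : α ≤ x := H.le_add s le_rfl
  have hx2 : x ≤ β := H.add_le s le_rfl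
  have hη0 : 0 ≤ η := (abs_nonneg _).trans (hosc s le_rfl hst)
  have hmono : ∀ {v : ℝ≥0 → ℝ} (_ : MonotoneOn v (Set.Iic s)) (c : ℝ),
      MonotoneOn (fun r => if r ≤ s then v r else v s + max c 0) (Set.Iic t) := by
    intro v hv c r _ r' _ hrr'
    dsimp only
    split_ifs with h1 h2 h2
    · exact hv h1 h2 hrr'
    · linarith [hv h1 (Set.mem_Iic.2 le_rfl) h1, le_max_right c 0]
    · exact absurd (hrr'.trans h2) h1
    · exact le_rfl
  -- The minimal pair up to s is continued by one jump that makes room for an oscillation η. As 2η ≤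
  -- β - α, at most one of the jumps is positive and it does not push the path through the opposite
  -- barrier; as x lies in [α, β], neither exceeds η. Minimality then bounds the true terms.
  have key : IsBarrierPair α β w t (fun r => if r ≤ s then U r else U s + max (x + η - β) 0)
      (fun r => if r ≤ s then L r else L s + max (α + η - x) 0) := by
    refine ⟨fun r hr => ?_, fun r hr => ?_, hmono H.upper_mono _, hmono H.lower_mono _,
      fun r hr => ?_, fun r hr => ?_⟩ <;> split_ifs with h
    · exact H.upper_nonneg r h
    · exact add_nonneg (H.upper_nonneg s le_rfl) (le_max_right _ _)
    · exact H.lower_nonneg r h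
    · exact add_nonneg (H.lower_nonneg s le_rfl) (le_max_right _ _)
    · exact H.le_add r h
    · have := abs_le.1 (hosc r (not_le.1 h).le hr)
      rcases max_cases (x + η - β) 0 with h1 | h1 <;>
        rcases max_cases (α + η - x) 0 with h2 | h2 <;> linarith
    · exact H.add_le r h
    · have := abs_le.1 (hosc r (not_le.1 h).le hr)
      rcases max_cases (x + η - β) 0 with h1 | h1 <;>
        rcases max_cases (α + η - x) 0 with h2 | h2 <;> linarith
  have h1 := key.upperLim_le
  have h2 := key.lowerLim_le
  simp only [not_le.2 hst', if_false] at h1 h2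
  have h3 : max (x + η - β) 0 ≤ η := max_le (by linarith) hη0
  have h4 : max (α + η - x) 0 ≤ η := max_le (by linarith) hη0
  exact ⟨h1.trans (by linarith), h2.trans (by linarith)⟩

theorem continuous_of_osc {v : ℝ≥0 → ℝ} (hv : Monotone v) (hw : Continuous w) {c : ℝ} (hc : 0 < c)
    (H : ∀ s t : ℝ≥0, s ≤ t → ∀ η, 2 * η ≤ c → (∀ r, s ≤ r → r ≤ t → |w r - w s| ≤ η) →
      v t ≤ v s + η) : Continuous v := by
  refine Metric.continuous_iff.2 fun s ε hε => ?_
  set η := min (ε / 2) (c / 2)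
  have hη : 0 < η := by positivity
  have h2η : 2 * η ≤ c := by linarith [min_le_right (ε / 2) (c / 2)]
  have hηε : η < ε := by linarith [min_le_left (ε / 2) (c / 2)]
  obtain ⟨δ, hδ, hd⟩ := Metric.continuous_iff.1 hw s (η / 2) (by positivity)
  refine ⟨δ, hδ, fun t ht => ?_⟩
  have hosc : ∀ {a b : ℝ≥0}, dist a s < δ → dist b s < δ → ∀ r, a ≤ r → r ≤ b →
      |w r - w a| ≤ η := by
    intro a b ha hb r har hrb
    have hr : dist r s < δ := by
      have h1 : -δ < (a : ℝ) - s ∧ (a : ℝ) - s < δ := abs_lt.1 ha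
      have h2 : -δ < (b : ℝ) - s ∧ (b : ℝ) - s < δ := abs_lt.1 hb
      have h3 : (a : ℝ) ≤ r := har
      have h4 : (r : ℝ) ≤ b := hrb
      change |(r : ℝ) - s| < δ
      exact abs_lt.2 ⟨by linarith [h1.1], by linarith [h2.2]⟩
    have := (dist_triangle_right (w r) (w a) (w s)).trans (add_le_add (hd r hr).le (hd a ha).le)
    rw [Real.dist_eq] at this
    linarith
  have hs : dist s s < δ := by simpa using hδ
  rw [Real.dist_eq]
  rcases le_total s t with h | h
  · rw [abs_of_nonneg (sub_nonneg.2 (hv h))]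
    linarith [H s t h η h2η (hosc hs ht)]
  · rw [abs_sub_comm, abs_of_nonneg (sub_nonneg.2 (hv h))]
    linarith [H t s h η h2η (hosc ht hs)]

theorem monotone_upperLim (hαβ : α < β) (hw : Continuous w) : Monotone (upperLim α β w) :=
  fun _ t hst => (isBarrierPair_lim hαβ hw t).upper_mono hst (Set.mem_Iic.2 le_rfl) hst

theorem monotone_lowerLim (hαβ : α < β) (hw : Continuous w) : Monotone (lowerLim α β w) :=
  fun _ t hst => (isBarrierPair_lim hαβ hw t).lower_mono hst (Set.mem_Iic.2 le_rfl) hst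

theorem continuous_upperLim (hαβ : α < β) (hw : Continuous w) : Continuous (upperLim α β w) :=
  continuous_of_osc (monotone_upperLim hαβ hw) hw (sub_pos.2 hαβ)
    fun _ _ hst _ hη h => (lim_sub_le hαβ hw hst hη h).1

theorem continuous_lowerLim (hαβ : α < β) (hw : Continuous w) : Continuous (lowerLim α β w) :=
  continuous_of_osc (monotone_lowerLim hαβ hw) hw (sub_pos.2 hαβ)
    fun _ _ hst _ hη h => (lim_sub_le hαβ hw hst hη h).2

/-- One inequality passes from the iterates to the limit, the other uses w - U + L ≤ β and
monotonicity of U. In this form w + L - β < U says that the reflected path is below β, so flatness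
follows from that of running suprema. -/
theorem upperLim_eq_runSup (hαβ : α < β) (hw : Continuous w) :
    upperLim α β w = runSup fun s => w s + lowerLim α β w s - β := by
  have hL := continuous_lowerLim hαβ hw
  funext t
  have H := isBarrierPair_lim hαβ hw t
  refine le_antisymm (ciSup_le fun n => runSup_le_runSup (by fun_prop) fun r _ => ?_)
    (runSup_le (H.upper_nonneg t le_rfl) fun r hr => ?_)
  · linarith [le_ciSup (bddAbove_lowerIter hαβ hw r) n, show lowerLim α β w r = ⨆ n, _ from rfl]
  · linarith [H.add_le r hr, H.upper_mono hr (Set.mem_Iic.2 le_rfl) hr]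

theorem lowerLim_eq_runSup (hαβ : α < β) (hw : Continuous w) :
    lowerLim α β w = runSup fun s => α - w s + upperLim α β w s := by
  have hU := continuous_upperLim hαβ hw
  funext t
  have H := isBarrierPair_lim hαβ hw t
  refine le_antisymm (ciSup_le fun n => (lowerIter_le_succ hw n t).trans
    (runSup_le_runSup (by fun_prop) fun r _ => ?_))
    (runSup_le (H.lower_nonneg t le_rfl) fun r hr => ?_)
  · change α - w r + upperIter α β w n r ≤ _
    linarith [le_ciSup (bddAbove_upperIter hαβ hw r) n, show upperLim α β w r = ⨆ n, _ from rfl]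
  · linarith [H.le_add r hr, H.lower_mono hr (Set.mem_Iic.2 le_rfl) hr]

/-- At time zero the zero pair is admissible, and the limit pair lies below it. -/
theorem lim_zero_of_mem (h1 : α ≤ w 0) (h2 : w 0 ≤ β) (hαβ : α < β) (hw : Continuous w) :
    upperLim α β w 0 = 0 ∧ lowerLim α β w 0 = 0 := by
  have H := isBarrierPair_lim hαβ hw 0
  have h0 : ∀ r : ℝ≥0, r ≤ 0 → r = 0 := fun r hr => hr.antisymm zero_le
  have h : IsBarrierPair α β w 0 (fun _ => 0) (fun _ => 0) :=
    ⟨fun _ _ => le_rfl, fun _ _ => le_rfl, monotoneOn_const, monotoneOn_const,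
      fun r hr => by simpa [h0 r hr] using h1, fun r hr => by simpa [h0 r hr] using h2⟩
  exact ⟨h.upperLim_le.antisymm (H.upper_nonneg 0 le_rfl),
    h.lowerLim_le.antisymm (H.lower_nonneg 0 le_rfl)⟩

theorem lowerIter_congr {w' : ℝ≥0 → ℝ} {t : ℝ≥0} (h : ∀ s ≤ t, w s = w' s) :
    ∀ n, ∀ s ≤ t, lowerIter α β w n s = lowerIter α β w' n s
  | 0, _, _ => rfl
  | n + 1, s, hs => runSup_congr fun r hr => by
    rw [h r (hr.trans hs), runSup_congr fun q hq => ?_]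
    have hq' := (hq.trans hr).trans hs
    rw [h q hq', lowerIter_congr h n q hq']

theorem upperIter_congr {w' : ℝ≥0 → ℝ} {t : ℝ≥0} (h : ∀ s ≤ t, w s = w' s) (n : ℕ) :
    upperIter α β w n t = upperIter α β w' n t :=
  runSup_congr fun q hq => by rw [h q hq, lowerIter_congr h n q hq]

theorem measurable_lowerIter {Ω : Type*} {m : MeasurableSpace Ω} {w : ℝ≥0 → Ω → ℝ}
    (hc : ∀ ω, Continuous fun t => w t ω) {t : ℝ≥0} (hm : ∀ s ≤ t, Measurable (w s)) :
    ∀ n, ∀ s ≤ t, Measurable fun ω => lowerIter α β (fun r => w r ω) n s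
  | 0, _, _ => measurable_const
  | n + 1, _, hs =>
    measurable_runSup (fun ω => continuous_lowerArg (hc ω) n) fun r hr =>
      (measurable_const.sub (hm r (hr.trans hs))).add
        (measurable_runSup (fun ω => continuous_upperArg (hc ω) n) fun q hq =>
          ((hm q ((hq.trans hr).trans hs)).add
            (measurable_lowerIter hc hm n q ((hq.trans hr).trans hs))).sub_const β)

theorem measurable_upperIter {Ω : Type*} {m : MeasurableSpace Ω} {w : ℝ≥0 → Ω → ℝ}
    (hc : ∀ ω, Continuous fun t => w t ω) {t : ℝ≥0} (hm : ∀ s ≤ t, Measurable (w s)) (n : ℕ) :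
    Measurable fun ω => upperIter α β (fun r => w r ω) n t :=
  measurable_runSup (fun ω => continuous_upperArg (hc ω) n) fun q hq =>
    ((hm q hq).add (measurable_lowerIter hc hm n q hq)).sub_const β

end TwoSided

/-! ### Reflection terms for a finite or infinite upper barrier -/

theorem closure_openInterval {α : ℝ} {β : WithTop ℝ} (h : (α : WithTop ℝ) < β) :
    closure (openInterval α β) = {x : ℝ | α ≤ x ∧ (x : WithTop ℝ) ≤ β} := by
  induction β using WithTop.recTopCoe with
  | top =>
    have : openInterval α ⊤ = Set.Ioi α := by ext x; simp [openInterval]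
    rw [this, closure_Ioi]
    ext x
    simp
  | coe β =>
    have h : α < β := WithTop.coe_lt_coe.1 h
    have : openInterval α β = Set.Ioo α β := by ext x; simp [openInterval]
    rw [this, closure_Ioo h.ne]
    ext x
    simp

/-- The upper barrier term of the path `w` reflected at `α` and `β`. -/
noncomputable def upperTerm (α : ℝ) (β : WithTop ℝ) (w : ℝ≥0 → ℝ) : ℝ≥0 → ℝ :=
  β.recTopCoe (fun _ => 0) fun β => upperLim α β w

/-- The lower barrier term of the path `w` reflected at `α` and `β`. -/
noncomputable def lowerTerm (α : ℝ) (β : WithTop ℝ) (w : ℝ≥0 → ℝ) : ℝ≥0 → ℝ :=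
  β.recTopCoe (runSup fun s => α - w s) fun β => lowerLim α β w

theorem pathMeasure_null_of_eq_runSup {u h : ℝ≥0 → ℝ} (hu : u = runSup h) (hh : Continuous h)
    (T : ℝ≥0) (hm : MonotoneOn u (Set.Iic T)) {S : Set ℝ≥0}
    (hS : ∀ s ∈ S, s ≤ T ∧ h s < u s) : pathMeasure T u hm S = 0 := by
  subst hu
  exact measure_mono_null hS (pathMeasure_runSup_null hh T hm)

/-- Writing the absent upper term as a running supremum lets the same flatness lemma cover an
infinite barrier. -/
theorem zero_eq_runSup : (fun _ : ℝ≥0 => (0 : ℝ)) = runSup fun _ => -1 :=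
  funext fun _ => (runSup_nonneg _ _).antisymm (runSup_le le_rfl fun _ _ => by norm_num)

theorem isReflectedPath_terms {α : ℝ} {β : WithTop ℝ} {w : ℝ≥0 → ℝ}
    (hw : Continuous w) (h0 : w 0 ∈ openInterval α β) (T : ℝ≥0) :
    IsReflectedPath T α β w (fun t => w t - upperTerm α β w t + lowerTerm α β w t)
      (upperTerm α β w) (lowerTerm α β w) := by
  have hαβ : (α : WithTop ℝ) < β := (WithTop.coe_lt_coe.2 h0.1).trans h0.2
  induction β using WithTop.recTopCoe with
  | top =>
    have hc : Continuous fun s => α - w s := by fun_prop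
    have hL := continuous_runSup hc
    change IsReflectedPath T α ⊤ w (fun t => w t - 0 + runSup (fun s => α - w s) t)
      (fun _ => 0) (runSup fun s => α - w s)
    refine ⟨fun t _ => ?_, by fun_prop, continuousOn_const, hL.continuousOn, rfl, ?_,
      monotoneOn_const, (runSup_mono hc).monotoneOn _, ?_, ?_, fun _ _ => rfl⟩
    · rw [closure_openInterval hαβ]
      have := le_runSup hc (le_refl t)
      exact ⟨by linarith, le_top⟩
    · refine (runSup_le le_rfl fun r hr => ?_).antisymm (runSup_nonneg _ _)
      rw [hr.antisymm zero_le]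
      linarith [h0.1]
    · exact pathMeasure_null_of_eq_runSup zero_eq_runSup continuous_const T _
        fun s hs => ⟨hs.1, by norm_num⟩
    · exact pathMeasure_null_of_eq_runSup rfl hc T _
        fun s hs => ⟨hs.1, by linarith [hs.2]⟩
  | coe β =>
    have hαβ' : α < β := WithTop.coe_lt_coe.1 hαβ
    have h0' : w 0 < β := WithTop.coe_lt_coe.1 h0.2
    have hU := continuous_upperLim hαβ' hw
    have hL := continuous_lowerLim hαβ' hw
    have hz := lim_zero_of_mem h0.1.le h0'.le hαβ' hw
    change IsReflectedPath T α β w (fun t => w t - upperLim α β w t + lowerLim α β w t)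
      (upperLim α β w) (lowerLim α β w)
    refine ⟨fun t _ => ?_, by fun_prop, hU.continuousOn, hL.continuousOn, hz.1, hz.2,
      (monotone_upperLim hαβ' hw).monotoneOn _, (monotone_lowerLim hαβ' hw).monotoneOn _,
      ?_, ?_, fun _ _ => rfl⟩
    · rw [closure_openInterval hαβ]
      have H := isBarrierPair_lim hαβ' hw t
      exact ⟨H.le_add t le_rfl, WithTop.coe_le_coe.2 (H.add_le t le_rfl)⟩
    · refine pathMeasure_null_of_eq_runSup (upperLim_eq_runSup hαβ' hw) (by fun_prop) T _
        fun s hs => ⟨hs.1, ?_⟩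
      have := WithTop.coe_lt_coe.1 hs.2
      linarith
    · exact pathMeasure_null_of_eq_runSup (lowerLim_eq_runSup hαβ' hw) (by fun_prop) T _
        fun s hs => ⟨hs.1, by linarith [hs.2]⟩

/-- Causality of the reflection map: it is what lets agreement of drivers up to t propagate through
the Picard iteration. -/
theorem terms_congr {α : ℝ} {β : WithTop ℝ} {w w' : ℝ≥0 → ℝ} {t : ℝ≥0}
    (h : ∀ s ≤ t, w s = w' s) :
    upperTerm α β w t = upperTerm α β w' t ∧ lowerTerm α β w t = lowerTerm α β w' t := by
  induction β using WithTop.recTopCoe with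
  | top => exact ⟨rfl, runSup_congr (h := fun s => α - w s) (h' := fun s => α - w' s)
      fun r hr => by simp only [h r hr]⟩
  | coe β =>
    exact ⟨iSup_congr fun n => upperIter_congr h n, iSup_congr fun n => lowerIter_congr h n t le_rfl⟩

theorem measurable_terms {Ω : Type*} {m : MeasurableSpace Ω} {α : ℝ} {β : WithTop ℝ}
    {w : ℝ≥0 → Ω → ℝ} (hc : ∀ ω, Continuous fun t => w t ω) {t : ℝ≥0}
    (hm : ∀ s ≤ t, Measurable (w s)) :
    Measurable (fun ω => upperTerm α β (fun s => w s ω) t) ∧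
      Measurable (fun ω => lowerTerm α β (fun s => w s ω) t) := by
  induction β using WithTop.recTopCoe with
  | top =>
    exact ⟨measurable_const, measurable_runSup (fun ω => continuous_const.sub (hc ω))
      fun s hs => measurable_const.sub (hm s hs)⟩
  | coe β =>
    exact ⟨Measurable.iSup fun n => measurable_upperIter hc hm n,
      Measurable.iSup fun n => measurable_lowerIter hc hm n t le_rfl⟩

/-! ### The driver, Picard iteration and existence -/

theorem continuous_driver {Ω : Type*} {Δ : ℝ≥0} (hΔ : 0 < Δ) (f g : ℝ → ℝ) (x₀ : ℝ)
    (B ξ : ℝ≥0 → Ω → ℝ) {ω : Ω} (hB : Continuous fun t => B t ω) :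
    Continuous fun t => driver f g x₀ Δ B ξ t ω := by
  refine continuous_iff_continuousAt.2 fun t => ?_
  set K := ⌊(t + 1) / Δ⌋₊ + 1
  have hev : (fun s => x₀ + gridSum Δ K (fun k => f (ξ ((k : ℝ≥0) * Δ) ω)) (fun s => (s : ℝ)) s
      + gridSum Δ K (fun k => g (ξ ((k : ℝ≥0) * Δ) ω)) (fun s => B s ω) s)
      =ᶠ[nhds t] fun s => driver f g x₀ Δ B ξ s ω := by
    filter_upwards [Iio_mem_nhds (lt_add_one t)] with s hs
    rw [driver_eq hΔ ((le_of_lt hs).trans (le_floor_succ_mul hΔ _))]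
  refine ContinuousAt.congr ?_ hev
  exact ((continuous_const.add (continuous_gridSum _ _ _ NNReal.continuous_coe)).add
    (continuous_gridSum _ _ _ hB)).continuousAt

theorem driver_zero {Ω : Type*} {Δ : ℝ≥0} (hΔ : 0 < Δ) (f g : ℝ → ℝ) (x₀ : ℝ)
    (B ξ : ℝ≥0 → Ω → ℝ) (ω : Ω) : driver f g x₀ Δ B ξ 0 ω = x₀ := by
  rw [driver_eq hΔ (K := 0) zero_le]
  simp

theorem gridSum_congr {Δ t : ℝ≥0} (K : ℕ) {c c' : ℕ → ℝ} {A A' : ℝ≥0 → ℝ}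
    (hc : ∀ k : ℕ, k * Δ < t → c k = c' k) (hA : ∀ s ≤ t, A s = A' s) :
    gridSum Δ K c A t = gridSum Δ K c' A' t := by
  refine Finset.sum_congr rfl fun k _ => ?_
  rw [hA _ (min_le_right _ _), hA _ (min_le_right _ _)]
  rcases lt_or_ge ((k : ℝ≥0) * Δ) t with h | h
  · rw [hc k h]
  · have h2 : t ≤ ((k + 1 : ℕ) : ℝ≥0) * Δ := h.trans (by gcongr; simp)
    rw [min_eq_right h, min_eq_right h2]
    simp

theorem driver_congr {Ω : Type*} {Δ t : ℝ≥0} (hΔ : 0 < Δ) {f g f' g' : ℝ → ℝ} (x₀ : ℝ)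
    {B ξ B' ξ' : ℝ≥0 → Ω → ℝ} {ω : Ω}
    (hf : ∀ k : ℕ, k * Δ < t → f (ξ (k * Δ) ω) = f' (ξ' (k * Δ) ω))
    (hg : ∀ k : ℕ, k * Δ < t → g (ξ (k * Δ) ω) = g' (ξ' (k * Δ) ω))
    (hB : ∀ s ≤ t, B s ω = B' s ω) :
    driver f g x₀ Δ B ξ t ω = driver f' g' x₀ Δ B' ξ' t ω := by
  rw [driver_eq hΔ (le_floor_succ_mul hΔ t), driver_eq hΔ (le_floor_succ_mul hΔ t),
    gridSum_congr _ hf fun _ _ => rfl, gridSum_congr _ hg hB]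

theorem measurable_driver {Ω : Type*} {m : MeasurableSpace Ω} {Δ t : ℝ≥0} (hΔ : 0 < Δ)
    {f g : ℝ → ℝ} (hf : Measurable f) (hg : Measurable g) (x₀ : ℝ) {B ξ : ℝ≥0 → Ω → ℝ}
    (hB : ∀ s ≤ t, Measurable (B s)) (hξ : ∀ s ≤ t, Measurable (ξ s)) :
    Measurable (driver f g x₀ Δ B ξ t) := by
  have h : driver f g x₀ Δ B ξ t = fun ω => _ :=
    funext fun ω => driver_eq hΔ (le_floor_succ_mul hΔ t) f g x₀ B ξ ω
  rw [h]
  have hk : ∀ k ∈ Finset.range (⌊t / Δ⌋₊ + 1), (k : ℝ≥0) * Δ ≤ t := fun k hk => by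
    rw [← le_div_iff₀ hΔ]
    exact (Nat.cast_le.2 (Nat.lt_succ_iff.1 (Finset.mem_range.1 hk))).trans
      (Nat.floor_le zero_le)
  refine (measurable_const.add (Finset.measurable_fun_sum _ fun k hk' => ?_)).add
    (Finset.measurable_fun_sum _ fun k hk' => ?_)
  · exact (hf.comp (hξ _ (hk k hk'))).mul_const _
  · exact (hg.comp (hξ _ (hk k hk'))).mul
      ((hB _ (min_le_right _ _)).sub (hB _ (min_le_right _ _)))

/-- Picard iteration for the reflected equation with coefficients frozen at the grid points. -/
noncomputable def picard {Ω : Type*} (f g : ℝ → ℝ) (x₀ : ℝ) (Δ : ℝ≥0) (α : ℝ) (β : WithTop ℝ)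
    (B : ℝ≥0 → Ω → ℝ) : ℕ → ℝ≥0 → Ω → ℝ
  | 0 => fun _ _ => x₀
  | n + 1 => fun t ω =>
    driver f g x₀ Δ B (picard f g x₀ Δ α β B n) t ω
      - upperTerm α β (fun s => driver f g x₀ Δ B (picard f g x₀ Δ α β B n) s ω) t
      + lowerTerm α β (fun s => driver f g x₀ Δ B (picard f g x₀ Δ α β B n) s ω) t

section Picard

variable {Ω : Type*} {f g : ℝ → ℝ} {x₀ : ℝ} {Δ : ℝ≥0} {α : ℝ} {β : WithTop ℝ}
  {B : ℝ≥0 → Ω → ℝ}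

theorem measurable_picard {m : MeasurableSpace Ω} (hΔ : 0 < Δ) (hf : Measurable f)
    (hg : Measurable g) (hc : ∀ ω, Continuous fun t => B t ω) {t : ℝ≥0}
    (hB : ∀ s ≤ t, Measurable (B s)) :
    ∀ n, ∀ s ≤ t, Measurable (picard f g x₀ Δ α β B n s)
  | 0, _, _ => measurable_const
  | n + 1, s, hs => by
    have hd : ∀ r ≤ s, Measurable (driver f g x₀ Δ B (picard f g x₀ Δ α β B n) r) :=
      fun r hr => measurable_driver hΔ hf hg x₀ (fun q hq => hB q ((hq.trans hr).trans hs))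
        fun q hq => measurable_picard hΔ hf hg hc hB n q ((hq.trans hr).trans hs)
    have ht := measurable_terms (α := α) (β := β)
      (fun ω => continuous_driver hΔ f g x₀ B (picard f g x₀ Δ α β B n) (hc ω)) hd
    exact ((hd s le_rfl).sub ht.1).add ht.2

theorem isReflectedPath_picard (hΔ : 0 < Δ) (hx : x₀ ∈ openInterval α β) {ω : Ω}
    (hc : Continuous fun t => B t ω) (n : ℕ) (T : ℝ≥0) :
    IsReflectedPath T α β (fun t => driver f g x₀ Δ B (picard f g x₀ Δ α β B n) t ω)
      (fun t => picard f g x₀ Δ α β B (n + 1) t ω)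
      (upperTerm α β fun s => driver f g x₀ Δ B (picard f g x₀ Δ α β B n) s ω)
      (lowerTerm α β fun s => driver f g x₀ Δ B (picard f g x₀ Δ α β B n) s ω) :=
  isReflectedPath_terms (continuous_driver hΔ f g x₀ B _ hc)
    (by rw [driver_zero hΔ]; exact hx) T

/-- The driver on [0, (n+1)Δ] reads only grid values up to nΔ, where two consecutive iterates agree
by induction. Each iteration makes one more step exact. -/
theorem picard_succ_eq (hΔ : 0 < Δ) (hx : x₀ ∈ openInterval α β) {ω : Ω}
    (hc : Continuous fun t => B t ω) : ∀ n : ℕ, ∀ t ≤ (n : ℝ≥0) * Δ,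
      picard f g x₀ Δ α β B n t ω = picard f g x₀ Δ α β B (n + 1) t ω
  | 0, t, ht => by
    have ht : t = 0 := by simpa using ht
    have H := isReflectedPath_picard (f := f) (g := g) hΔ hx hc 0 0
    have h1 := H.eq 0 le_rfl
    have h2 := H.upper_zero
    have h3 := H.lower_zero
    simp only [h2, h3, driver_zero hΔ] at h1
    rw [ht, h1, sub_zero, add_zero]
    rfl
  | n + 1, t, ht => by
    have hd : ∀ s ≤ t, driver f g x₀ Δ B (picard f g x₀ Δ α β B n) s ω
        = driver f g x₀ Δ B (picard f g x₀ Δ α β B (n + 1)) s ω := by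
      intro s hs
      have hk : ∀ k : ℕ, k * Δ < s → picard f g x₀ Δ α β B n (k * Δ) ω
          = picard f g x₀ Δ α β B (n + 1) (k * Δ) ω := by
        intro k hk
        refine picard_succ_eq hΔ hx hc n _ ?_
        -- Strictness of kΔ < s matters: the value at (n+1)Δ itself is never read.
        have h1 : (k : ℝ≥0) < (n + 1 : ℕ) := lt_of_mul_lt_mul_right' (hk.trans_le (hs.trans ht))
        have h2 : k ≤ n := Nat.lt_succ_iff.1 (Nat.cast_lt.1 h1)
        gcongr
      exact driver_congr hΔ x₀ (fun k h => by rw [hk k h]) (fun k h => by rw [hk k h])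
        fun _ _ => rfl
    have ht' := terms_congr (α := α) (β := β) hd
    change driver f g x₀ Δ B (picard f g x₀ Δ α β B n) t ω - upperTerm α β _ t
      + lowerTerm α β _ t = driver f g x₀ Δ B (picard f g x₀ Δ α β B (n + 1)) t ω
      - upperTerm α β _ t + lowerTerm α β _ t
    rw [hd t le_rfl, ht'.1, ht'.2]

end Picard

theorem IsReflectedPath.congr_driver {T : ℝ≥0} {α : ℝ} {β : WithTop ℝ} {w w' x u l : ℝ≥0 → ℝ}
    (h : IsReflectedPath T α β w x u l) (hw : ∀ t ≤ T, w t = w' t) :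
    IsReflectedPath T α β w' x u l :=
  { h with eq := fun t ht => by rw [h.eq t ht, hw t ht] }

/-- The paths are set to zero on the null set of discontinuity, which belongs to ℱ 0 by
completeness, so adaptedness survives. With every path continuous, the pathwise construction needs
no exceptional set. -/
theorem exists_continuous_modification {Ω : Type*} {mΩ : MeasurableSpace Ω} {P : Measure Ω}
    {ℱ : Filtration ℝ≥0 mΩ} (hℱ : UsualConditions ℱ P) {B : ℝ≥0 → Ω → ℝ}
    (hB : IsFilteredBrownian B ℱ P) :
    ∃ B' : ℝ≥0 → Ω → ℝ, (∀ ω, Continuous fun t => B' t ω) ∧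
      (∀ t, Measurable[ℱ t] (B' t)) ∧ ∀ᵐ ω ∂P, ∀ t, B' t ω = B t ω := by
  classical
  set S : Set Ω := {ω | Continuous fun t => B t ω}
  have hS : P Sᶜ = 0 := hB.isBrownian.cont
  have hSm : ∀ t, MeasurableSet[ℱ t] S := fun t => by
    have := ℱ.mono zero_le _ (hℱ.complete _ hS) (j := t)
    simpa using MeasurableSet.compl (m := ℱ t) this
  refine ⟨fun t => S.indicator (B t), fun ω => ?_, fun t => ?_, ?_⟩
  · by_cases h : ω ∈ S
    · have h1 : ∀ t, S.indicator (B t) ω = B t ω := fun t => Set.indicator_of_mem h _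
      simp only [h1]
      exact h
    · simp [h, continuous_const]
  · exact (hB.adapted t).measurable.indicator (hSm t)
  · filter_upwards [hB.isBrownian.cont] with ω hω t
    exact Set.indicator_of_mem (s := S) hω _

/-- Existence of the scheme. -/
theorem exists_isScheme {Ω : Type*} {mΩ : MeasurableSpace Ω} {P : Measure Ω}
    {ℱ : Filtration ℝ≥0 mΩ} (hℱ : UsualConditions ℱ P) {B : ℝ≥0 → Ω → ℝ}
    (hB : IsFilteredBrownian B ℱ P) (T : ℝ≥0) {f g f' g' : ℝ → ℝ} (hf' : Measurable f')
    (hg' : Measurable g') {x₀ a : ℝ} {b : WithTop ℝ} {N : ℕ} (hx : x₀ ∈ domainN a b N)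
    (hf : Set.EqOn f f' (closure (domainN a b N))) (hg : Set.EqOn g g' (closure (domainN a b N)))
    {Δ : ℝ≥0} (hΔ : 0 < Δ) :
    ∃ ξ U L : ℝ≥0 → Ω → ℝ, IsScheme P ℱ B T f g x₀ a b N Δ ξ U L := by
  obtain ⟨B', hc, hm, hBB'⟩ := exists_continuous_modification hℱ hB
  set α := lowerBarrier a N
  set β := upperBarrier b N
  set n := ⌊T / Δ⌋₊ + 1
  have hn : T ≤ n * Δ := le_floor_succ_mul hΔ T
  set η := picard f' g' x₀ Δ α β B'
  have hηm : ∀ n t, ∀ s ≤ t, Measurable[ℱ t] (η n s) := fun n t =>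
    measurable_picard (m := ℱ t) hΔ hf' hg' hc (fun s hs => (hm s).mono (ℱ.mono hs) le_rfl) n
  have htm := fun t => measurable_terms (m := ℱ t) (α := α) (β := β) (t := t)
    (fun ω => continuous_driver hΔ f' g' x₀ B' (η n) (hc ω))
    (fun s hs => measurable_driver (m := ℱ t) hΔ hf' hg' x₀
      (fun r hr => (hm r).mono (ℱ.mono (hr.trans hs)) le_rfl)
      fun r hr => hηm n t r (hr.trans hs))
  refine ⟨η (n + 1), fun t ω => upperTerm α β (fun s => driver f' g' x₀ Δ B' (η n) s ω) t,
    fun t ω => lowerTerm α β (fun s => driver f' g' x₀ Δ B' (η n) s ω) t,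
    fun t _ => (hηm _ t t le_rfl).stronglyMeasurable, fun t _ => (htm t).1.stronglyMeasurable,
    fun t _ => (htm t).2.stronglyMeasurable, ?_⟩
  filter_upwards [hBB'] with ω hω
  have H := isReflectedPath_picard (f := f') (g := g') hΔ hx (hc ω) n T
  refine H.congr_driver fun t ht => ?_
  -- Up to T iterates n and n + 1 agree at the grid points, so iterate n + 1 solves the equation
  -- driven by itself; its values lie in cl D_N, so `f'` and `g'` may be exchanged for `f` and `g`.
  have hk : ∀ k : ℕ, k * Δ < t → η n (k * Δ) ω = η (n + 1) (k * Δ) ω ∧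
      η (n + 1) (k * Δ) ω ∈ closure (domainN a b N) := fun k hk =>
    ⟨picard_succ_eq hΔ hx (hc ω) n _ ((hk.le.trans ht).trans hn), H.mem _ (hk.le.trans ht)⟩
  exact driver_congr hΔ x₀ (fun k h => (congrArg f' (hk k h).1).trans (hf (hk k h).2).symm)
    (fun k h => (congrArg g' (hk k h).1).trans (hg (hk k h).2).symm) fun s _ => hω s

/-! ### Doob's maximal inequality -/

/-- The running maximum `max_{i ≤ k} |x i|`. -/
noncomputable def runMax (x : ℕ → ℝ) : ℕ → ℝ
  | 0 => |x 0|
  | k + 1 => max (runMax x k) |x (k + 1)|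

theorem abs_le_runMax (x : ℕ → ℝ) : ∀ {i k : ℕ}, i ≤ k → |x i| ≤ runMax x k
  | i, 0, h => by rw [Nat.le_zero.1 h]; exact le_rfl
  | i, k + 1, h => by
    rcases Nat.le_succ_iff.1 h with h | rfl
    · exact (abs_le_runMax x h).trans (le_max_left _ _)
    · exact le_max_right _ _

theorem runMax_nonneg (x : ℕ → ℝ) (k : ℕ) : 0 ≤ runMax x k :=
  (abs_nonneg _).trans (abs_le_runMax x (Nat.zero_le k))

theorem two_mul_mul_pow_le {x y : ℝ} (hy : 0 ≤ y) (hxy : y ≤ x) (n : ℕ) :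
    2 * (x * y ^ (n + 1)) ≤ x ^ (n + 2) + y ^ (n + 2) := by
  have h1 : y ^ n ≤ x ^ n := pow_le_pow_left₀ hy hxy n
  have h2 : 0 ≤ y ^ n := pow_nonneg hy n
  have h3 : 0 ≤ (x ^ n - y ^ n) * x ^ 2 := mul_nonneg (sub_nonneg.2 h1) (sq_nonneg x)
  have h4 : 0 ≤ y ^ n * (x - y) ^ 2 := mul_nonneg h2 (sq_nonneg _)
  have h5 : x ^ (n + 2) + y ^ (n + 2) - 2 * (x * y ^ (n + 1))
      = (x ^ n - y ^ n) * x ^ 2 + y ^ n * (x - y) ^ 2 := by ring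
  linarith

/-- The sign of `x`, with value `1` at zero. -/
noncomputable def sgn (x : ℝ) : ℝ := if 0 ≤ x then 1 else -1

theorem sgn_mul_self (x : ℝ) : sgn x * x = |x| := by
  unfold sgn
  split_ifs with h
  · rw [one_mul, abs_of_nonneg h]
  · rw [abs_of_neg (not_le.1 h), neg_one_mul]

theorem abs_sgn (x : ℝ) : |sgn x| = 1 := by
  unfold sgn
  split_ifs <;> simp

theorem sgn_mul_le (x y : ℝ) : sgn x * y ≤ |y| := by
  refine (le_abs_self _).trans ?_
  rw [abs_mul, abs_sgn, one_mul]

theorem measurable_sgn : Measurable sgn :=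
  Measurable.ite measurableSet_Ici measurable_const measurable_const

/-- Pathwise form of Doob's maximal inequality. -/
theorem runMax_pow_le (x : ℕ → ℝ) (n : ℕ) : ∀ k : ℕ,
    runMax x k ^ (n + 2) / 2 ≤ runMax x k ^ (n + 1) * |x k|
      - ∑ i ∈ Finset.range k, runMax x i ^ (n + 1) * sgn (x i) * (x (i + 1) - x i)
  | 0 => by
    have : (0 : ℝ) ≤ |x 0| ^ (n + 2) := by positivity
    simp only [runMax, Finset.range_zero, Finset.sum_empty, sub_zero, ← pow_succ]
    linarith
  | k + 1 => by
    have ih := runMax_pow_le x n k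
    rw [Finset.sum_range_succ]
    have hS := runMax_nonneg x k
    have h0 : 0 ≤ runMax x k ^ (n + 1) := pow_nonneg hS _
    -- `sgn (x k)` is a subgradient of the absolute value at `x k`. This settles a step without a
    -- new maximum; at a new maximum the weight changes too, which `two_mul_mul_pow_le` pays for.
    have h1 : runMax x k ^ (n + 1) * sgn (x k) * (x (k + 1) - x k)
        ≤ runMax x k ^ (n + 1) * |x (k + 1)| - runMax x k ^ (n + 1) * |x k| := by
      have := mul_le_mul_of_nonneg_left (sgn_mul_le (x k) (x (k + 1))) h0
      rw [← sgn_mul_self (x k)]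
      linarith
    rcases le_total |x (k + 1)| (runMax x k) with h | h
    · simp only [runMax, max_eq_left h]
      linarith
    · simp only [runMax, max_eq_right h]
      have h2 := two_mul_mul_pow_le hS h n
      have h3 : |x (k + 1)| ^ (n + 1) * |x (k + 1)| = |x (k + 1)| ^ (n + 2) := (pow_succ _ _).symm
      linarith

/-- Young's inequality by cases; the quarter is small enough to be absorbed by the one half in
`runMax_pow_le`. -/
theorem pow_mul_le_quarter {s a : ℝ} (hs : 0 ≤ s) (ha : 0 ≤ a) (n : ℕ) :
    s ^ (n + 1) * a ≤ s ^ (n + 2) / 4 + 4 ^ (n + 1) * a ^ (n + 2) := by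
  rcases le_total (4 * a) s with h | h
  · have h1 : s ^ (n + 1) * a ≤ s ^ (n + 1) * (s / 4) := by gcongr; linarith
    have h2 : 0 ≤ 4 ^ (n + 1) * a ^ (n + 2) := by positivity
    have h3 : s ^ (n + 1) * (s / 4) = s ^ (n + 2) / 4 := by ring
    linarith
  · have h1 : s ^ (n + 1) * a ≤ (4 * a) ^ (n + 1) * a := by gcongr
    have h2 : 0 ≤ s ^ (n + 2) / 4 := by positivity
    have h3 : (4 * a) ^ (n + 1) * a = 4 ^ (n + 1) * a ^ (n + 2) := by ring
    linarith

section

variable {Ω : Type*} {mΩ : MeasurableSpace Ω} {P : Measure Ω}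

theorem integrable_abs_pow {X : Ω → ℝ} {q : ℕ} [IsFiniteMeasure P] (hX : MemLp X q P) :
    Integrable (fun ω => |X ω| ^ q) P :=
  hX.integrable_norm_pow'

theorem pow_mul_le_add {x z : ℝ} (hx : 0 ≤ x) (hz : 0 ≤ z) (n : ℕ) :
    x ^ n * z ≤ x ^ (n + 1) + z ^ (n + 1) := by
  rcases le_total x z with h | h
  · have : x ^ n * z ≤ z ^ n * z := by gcongr
    have h2 : 0 ≤ x ^ (n + 1) := by positivity
    rw [← pow_succ] at this
    linarith
  · have : x ^ n * z ≤ x ^ n * x := by gcongr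
    have h2 : 0 ≤ z ^ (n + 1) := by positivity
    rw [← pow_succ] at this
    linarith

theorem integrable_of_abs_le_pow_mul [IsFiniteMeasure P] {X Y Z : Ω → ℝ} {n : ℕ}
    (hY : AEStronglyMeasurable Y P) (hX : MemLp X (n + 1 : ℕ) P) (hZ : MemLp Z (n + 1 : ℕ) P)
    (h : ∀ ω, |Y ω| ≤ |X ω| ^ n * |Z ω|) : Integrable Y P := by
  refine ((integrable_abs_pow hX).add (integrable_abs_pow hZ)).mono' hY (ae_of_all _ fun ω => ?_)
  exact (h ω).trans (pow_mul_le_add (abs_nonneg _) (abs_nonneg _) n)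

theorem memLp_runMax {M : ℕ → Ω → ℝ} {q : ℝ≥0∞} (hM : ∀ k, MemLp (M k) q P) :
    ∀ k, MemLp (fun ω => runMax (fun i => M i ω) k) q P
  | 0 => (hM 0).norm
  | k + 1 => by
    refine ((memLp_runMax hM k).norm.add (hM (k + 1)).norm).of_le
      ((memLp_runMax hM k).1.sup (hM (k + 1)).norm.1) (ae_of_all _ fun ω => ?_)
    have h1 := runMax_nonneg (fun i => M i ω) k
    have h2 := abs_nonneg (M (k + 1) ω)
    simp only [Pi.add_apply, Real.norm_eq_abs]
    change |max _ _| ≤ _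
    rw [abs_of_nonneg (le_max_of_le_left h1), abs_of_nonneg h1,
      abs_of_nonneg (add_nonneg h1 h2)]
    exact max_le (le_add_of_nonneg_right h2) (le_add_of_nonneg_left h1)

theorem integral_mul_martingale_sub [IsFiniteMeasure P] {ι : Type*} [Preorder ι]
    {ℱ : Filtration ι mΩ} {M : ι → Ω → ℝ} (hM : Martingale M ℱ P) {s t : ι} (hst : s ≤ t)
    {X : Ω → ℝ} (hX : StronglyMeasurable[ℱ s] X)
    (hint : Integrable (fun ω => X ω * (M t ω - M s ω)) P) :
    ∫ ω, X ω * (M t ω - M s ω) ∂P = 0 := by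
  have h1 : P[M t - M s | ℱ s] =ᵐ[P] 0 := by
    filter_upwards [condExp_sub (hM.integrable t) (hM.integrable s) (ℱ s), hM.2 s t hst,
      hM.2 s s le_rfl] with ω h1 h2 h3
    rw [h1, Pi.sub_apply, h2, h3, sub_self, Pi.zero_apply]
  have h2 := condExp_mul_of_stronglyMeasurable_left (μ := P) (f := X) (g := M t - M s) hX hint
    ((hM.integrable t).sub (hM.integrable s))
  rw [← integral_condExp (ℱ.le s)]
  change ∫ ω, (P[X * (M t - M s) | ℱ s]) ω ∂P = 0
  rw [integral_congr_ae (g := fun _ => 0), integral_zero]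
  filter_upwards [h1, h2] with ω h1 h2
  rw [h2, Pi.mul_apply, h1, Pi.zero_apply, mul_zero]

theorem measurable_runMax {m : MeasurableSpace Ω} {M : ℕ → Ω → ℝ} :
    ∀ k, (∀ i ≤ k, Measurable (M i)) → Measurable (fun ω => runMax (fun i => M i ω) k)
  | 0, h => (h 0 le_rfl).abs
  | k + 1, h => (measurable_runMax k fun i hi => h i (hi.trans k.le_succ)).max
      (h (k + 1) le_rfl).abs

/-- Doob's maximal inequality in `L^(n+2)` for discrete martingales. -/
theorem integral_runMax_pow_le [IsFiniteMeasure P] {ℱ : Filtration ℕ mΩ} {M : ℕ → Ω → ℝ}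
    (hM : Martingale M ℱ P) {n : ℕ} (hL : ∀ k, MemLp (M k) (n + 2 : ℕ) P) (k : ℕ) :
    ∫ ω, runMax (fun i => M i ω) k ^ (n + 2) ∂P ≤ 4 ^ (n + 2) * ∫ ω, |M k ω| ^ (n + 2) ∂P := by
  set S : ℕ → Ω → ℝ := fun i ω => runMax (fun j => M j ω) i with hS
  have hS0 : ∀ i ω, 0 ≤ S i ω := fun i ω => runMax_nonneg _ _
  have hSL : ∀ i, MemLp (S i) (n + 2 : ℕ) P := memLp_runMax hL
  have hSI : Integrable (fun ω => S k ω ^ (n + 2)) P := by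
    refine (integrable_abs_pow (hSL k)).congr (ae_of_all _ fun ω => ?_)
    simp only [abs_of_nonneg (hS0 k ω)]
  have hX : ∀ i, StronglyMeasurable[ℱ i] fun ω => S i ω ^ (n + 1) * sgn (M i ω) := fun i => by
    have hm : ∀ j ≤ i, Measurable[ℱ i] (M j) := fun j hj =>
      ((hM.1 j).mono (ℱ.mono hj)).measurable
    refine Measurable.stronglyMeasurable ?_
    exact ((measurable_runMax i hm).pow_const _).mul
      (measurable_sgn.comp (hm i le_rfl))
  have hDI : ∀ i, Integrable
      (fun ω => S i ω ^ (n + 1) * sgn (M i ω) * (M (i + 1) ω - M i ω)) P := fun i => by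
    refine integrable_of_abs_le_pow_mul ?_ (hSL i) ((hL (i + 1)).sub (hL i)) fun ω => ?_
    · exact ((hX i).mono (ℱ.le i)).aestronglyMeasurable.mul ((hL (i + 1)).sub (hL i)).1
    · rw [abs_mul, abs_mul, abs_sgn, abs_pow, mul_one]
      exact le_rfl
  have hD : ∀ i, ∫ ω, S i ω ^ (n + 1) * sgn (M i ω) * (M (i + 1) ω - M i ω) ∂P = 0 := fun i =>
    integral_mul_martingale_sub hM i.le_succ (hX i) (hDI i)
  have hsum : ∫ ω, ∑ i ∈ Finset.range k,
      S i ω ^ (n + 1) * sgn (M i ω) * (M (i + 1) ω - M i ω) ∂P = 0 := by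
    rw [integral_finsetSum _ fun i _ => hDI i]
    exact Finset.sum_eq_zero fun i _ => hD i
  -- The subtracted sum is a martingale transform with mean zero. A quarter of the left side remains
  -- after absorption, and multiplying by 4 turns 4^(n+1) into 4^(n+2).
  have hpt : ∀ ω, S k ω ^ (n + 2) / 4 ≤ 4 ^ (n + 1) * |M k ω| ^ (n + 2)
      - ∑ i ∈ Finset.range k, S i ω ^ (n + 1) * sgn (M i ω) * (M (i + 1) ω - M i ω) := fun ω => by
    have h1 := runMax_pow_le (fun i => M i ω) n k
    have h2 := pow_mul_le_quarter (hS0 k ω) (abs_nonneg (M k ω)) n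
    simp only [hS] at h2 ⊢
    linarith
  have hI1 : Integrable (fun ω => 4 ^ (n + 1) * |M k ω| ^ (n + 2)) P :=
    (integrable_abs_pow (hL k)).const_mul _
  have hI2 : Integrable (fun ω => ∑ i ∈ Finset.range k,
      S i ω ^ (n + 1) * sgn (M i ω) * (M (i + 1) ω - M i ω)) P :=
    integrable_finsetSum _ fun i _ => hDI i
  have := integral_mono (hSI.div_const 4) (hI1.sub hI2) hpt
  rw [integral_div, integral_sub' hI1 hI2, hsum, integral_const_mul] at this
  rw [pow_succ 4 (n + 1)]
  linarith

/-- Doob's maximal inequality in `L^(n+2)` for martingales with continuous paths. -/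
theorem lintegral_iSup_abs_pow_le [IsFiniteMeasure P] {ℱ : Filtration ℝ≥0 mΩ}
    {M : ℝ≥0 → Ω → ℝ} (hM : Martingale M ℱ P) {n : ℕ} (hL : ∀ t, MemLp (M t) (n + 2 : ℕ) P)
    (hc : ∀ᵐ ω ∂P, Continuous fun t => M t ω) (τ : ℝ≥0) :
    ∫⁻ ω, ⨆ t ∈ Set.Iic τ, ENNReal.ofReal (|M t ω| ^ (n + 2)) ∂P
      ≤ ENNReal.ofReal (4 ^ (n + 2) * ∫ ω, |M τ ω| ^ (n + 2) ∂P) := by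
  -- Grids of mesh at most 1/(m+1), stopped at τ. By continuity every |M t| is a limit of grid
  -- values, so the supremum is below the liminf of the grid maxima, and Fatou transfers the
  -- discrete bound.
  set r : ℕ → ℕ → ℝ≥0 := fun m j => min ((j : ℝ≥0) / (m + 1 : ℕ)) τ with hr
  set l : ℕ → ℕ := fun m => ⌈τ * (m + 1 : ℕ)⌉₊ with hl
  have hrmono : ∀ m, Monotone (r m) := fun m i j hij => by
    simp only [hr]
    gcongr
  have hrl : ∀ m, r m (l m) = τ := fun m => by
    simp only [hr]
    refine min_eq_right ?_
    rw [le_div_iff₀ (by positivity)]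
    exact Nat.le_ceil _
  set S : ℕ → Ω → ℝ := fun m ω => runMax (fun j => M (r m j) ω) (l m) with hS
  have hSm : ∀ m, Measurable (S m) := fun m => measurable_runMax _ fun i _ =>
    ((hM.1 (r m i)).mono (ℱ.le _)).measurable
  have hmart : ∀ m, ∫⁻ ω, ENNReal.ofReal (S m ω ^ (n + 2)) ∂P
      ≤ ENNReal.ofReal (4 ^ (n + 2) * ∫ ω, |M τ ω| ^ (n + 2) ∂P) := fun m => by
    let 𝒢 : Filtration ℕ mΩ :=
      ⟨fun j => ℱ (r m j), fun i j hij => ℱ.mono (hrmono m hij), fun j => ℱ.le _⟩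
    have h𝒢 : Martingale (fun j => M (r m j)) 𝒢 P :=
      ⟨fun j => hM.1 _, fun i j hij => hM.2 _ _ (hrmono m hij)⟩
    have h := integral_runMax_pow_le h𝒢 (fun k => hL _) (l m)
    rw [hrl] at h
    rw [← ofReal_integral_eq_lintegral_ofReal]
    · exact ENNReal.ofReal_le_ofReal h
    · refine (integrable_abs_pow (memLp_runMax (fun k => hL (r m k)) (l m))).congr
        (ae_of_all _ fun ω => ?_)
      simp only [hS, abs_of_nonneg (runMax_nonneg (fun j => M (r m j) ω) (l m))]
    · exact ae_of_all _ fun ω => pow_nonneg (runMax_nonneg _ _) _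
  calc ∫⁻ ω, ⨆ t ∈ Set.Iic τ, ENNReal.ofReal (|M t ω| ^ (n + 2)) ∂P
      ≤ ∫⁻ ω, Filter.liminf (fun m => ENNReal.ofReal (S m ω ^ (n + 2))) Filter.atTop ∂P := by
        refine lintegral_mono_ae ?_
        filter_upwards [hc] with ω hω
        refine iSup₂_le fun t ht => ?_
        set j : ℕ → ℕ := fun m => ⌊t * (m + 1 : ℕ)⌋₊
        have hj : ∀ m, j m ≤ l m := fun m =>
          (Nat.floor_le_ceil _).trans (Nat.ceil_mono (by gcongr; exact ht))
        have hlim : Filter.Tendsto (fun m => r m (j m)) Filter.atTop (nhds t) := by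
          have h1 : Filter.Tendsto (fun m : ℕ => (⌊t * ((m + 1 : ℕ) : ℝ≥0)⌋₊ : ℝ≥0) / (m + 1 : ℕ))
              Filter.atTop (nhds t) := by
            have h := (tendsto_nat_floor_mul_div_atTop (R := ℝ) t.2).comp
              (tendsto_natCast_atTop_atTop.comp (Filter.tendsto_add_atTop_nat 1))
            refine NNReal.tendsto_coe.1 (h.congr fun m => ?_)
            have h2 : ⌊(t : ℝ) * ((m : ℝ) + 1)⌋₊ = ⌊t * ((m : ℝ≥0) + 1)⌋₊ :=
              Nonneg.nat_floor_coe (t * ((m : ℝ≥0) + 1))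
            simp [h2]
          have h2 := h1.min (tendsto_const_nhds (x := τ))
          rwa [min_eq_left ht] at h2
        have hlim2 : Filter.Tendsto (fun m => ENNReal.ofReal (|M (r m (j m)) ω| ^ (n + 2)))
            Filter.atTop (nhds (ENNReal.ofReal (|M t ω| ^ (n + 2)))) :=
          ENNReal.tendsto_ofReal ((((hω.tendsto t).comp hlim).abs).pow _)
        rw [← hlim2.liminf_eq]
        refine Filter.liminf_le_liminf (Filter.Eventually.of_forall fun m => ?_)
        refine ENNReal.ofReal_le_ofReal (pow_le_pow_left₀ (abs_nonneg _) ?_ _)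
        exact abs_le_runMax (fun j => M (r m j) ω) (hj m)
    _ ≤ Filter.liminf (fun m => ∫⁻ ω, ENNReal.ofReal (S m ω ^ (n + 2)) ∂P) Filter.atTop :=
        lintegral_liminf_le fun m => ((hSm m).pow_const _).ennreal_ofReal
    _ ≤ _ := by
        refine Filter.liminf_le_of_frequently_le' (Filter.Frequently.of_forall fun m => hmart m)

end

/-! ### Power expansions and Gaussian moments -/

/-- Second order expansion of a power. -/
theorem abs_add_pow_sub_le (x y : ℝ) : ∀ n : ℕ,
    |(x + y) ^ (n + 2) - x ^ (n + 2) - (n + 2) * x ^ (n + 1) * y|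
      ≤ (n + 2) ^ 2 * (y ^ 2 * (|x| + |y|) ^ n)
  | 0 => by
    norm_num
    rw [show (x + y) ^ 2 - x ^ 2 - 2 * x * y = y ^ 2 by ring, abs_of_nonneg (sq_nonneg y)]
    nlinarith [sq_nonneg y]
  | n + 1 => by
    have ih := abs_add_pow_sub_le x y n
    set R := (x + y) ^ (n + 2) - x ^ (n + 2) - (n + 2) * x ^ (n + 1) * y with hR
    have h1 : (x + y) ^ (n + 1 + 2) - x ^ (n + 1 + 2) - ((n + 1 : ℕ) + 2) * x ^ (n + 1 + 1) * y
        = (x + y) * R + (n + 2) * (x ^ (n + 1) * y ^ 2) := by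
      rw [hR]
      push_cast
      ring
    have hs : 0 ≤ |x| + |y| := by positivity
    have h2 : |(x + y) * R| ≤ (|x| + |y|) * ((n + 2) ^ 2 * (y ^ 2 * (|x| + |y|) ^ n)) := by
      rw [abs_mul]
      exact mul_le_mul (abs_add_le x y) ih (abs_nonneg _) hs
    have h3 : |((n : ℝ) + 2) * (x ^ (n + 1) * y ^ 2)|
        ≤ (n + 2) * ((|x| + |y|) ^ (n + 1) * y ^ 2) := by
      rw [abs_mul, abs_mul, abs_pow, abs_of_nonneg (sq_nonneg y),
        abs_of_nonneg (by positivity : (0 : ℝ) ≤ n + 2)]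
      gcongr
      linarith [abs_nonneg y]
    rw [h1]
    refine (abs_add_le _ _).trans ((add_le_add h2 h3).trans ?_)
    have h4 : 0 ≤ y ^ 2 * (|x| + |y|) ^ (n + 1) := by positivity
    have h5 : (|x| + |y|) * (((n : ℝ) + 2) ^ 2 * (y ^ 2 * (|x| + |y|) ^ n))
        + (n + 2) * ((|x| + |y|) ^ (n + 1) * y ^ 2)
        = (((n : ℝ) + 2) ^ 2 + (n + 2)) * (y ^ 2 * (|x| + |y|) ^ (n + 1)) := by ring
    rw [h5]
    refine mul_le_mul_of_nonneg_right ?_ h4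
    push_cast
    nlinarith

/-- The remainder is a function of the past (x, g) times a function of the increment z alone, so
that independence will factor its expectation; the factor z² supplies the order of the step length.
-/
theorem add_mul_pow_le (x g z : ℝ) (n : ℕ) :
    (x + g * z) ^ (n + 2) ≤ x ^ (n + 2) + (n + 2) * (x ^ (n + 1) * g * z)
      + (n + 2) ^ 2 * ((|x| + |g|) ^ (n + 2) * (z ^ 2 * (1 + |z|) ^ n)) := by
  have h1 := (abs_le.1 (abs_add_pow_sub_le x (g * z) n)).2
  have h2 : (g * z) ^ 2 * (|x| + |g * z|) ^ n
      ≤ (|x| + |g|) ^ (n + 2) * (z ^ 2 * (1 + |z|) ^ n) := by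
    have h3 : |x| + |g * z| ≤ (|x| + |g|) * (1 + |z|) := by
      rw [abs_mul]
      nlinarith [abs_nonneg x, abs_nonneg g, abs_nonneg z, mul_nonneg (abs_nonneg x) (abs_nonneg z)]
    have h4 : g ^ 2 ≤ (|x| + |g|) ^ 2 := by
      rw [← sq_abs g]
      gcongr
      linarith [abs_nonneg x]
    calc (g * z) ^ 2 * (|x| + |g * z|) ^ n
        = g ^ 2 * z ^ 2 * (|x| + |g * z|) ^ n := by rw [mul_pow]
      _ ≤ (|x| + |g|) ^ 2 * z ^ 2 * ((|x| + |g|) * (1 + |z|)) ^ n := by gcongr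
      _ = _ := by rw [mul_pow]; ring
  have h5 : ((n : ℝ) + 2) ^ 2 * ((g * z) ^ 2 * (|x| + |g * z|) ^ n)
      ≤ (n + 2) ^ 2 * ((|x| + |g|) ^ (n + 2) * (z ^ 2 * (1 + |z|) ^ n)) := by gcongr
  linarith

theorem integrable_sq_mul_pow {Ω : Type*} {mΩ : MeasurableSpace Ω} {P : Measure Ω}
    [IsFiniteMeasure P] {Z : Ω → ℝ} {n : ℕ} (hZ : MemLp Z (n + 2 : ℕ) P) {c : ℝ} (hc : 0 ≤ c) :
    Integrable (fun ω => Z ω ^ 2 * (1 + c * |Z ω|) ^ n) P := by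
  have h0 : MemLp (fun ω => (1 + c) * |Z ω|) (n + 2 : ℕ) P := hZ.norm.const_mul (1 + c)
  have h1 : MemLp (fun ω => 1 + (1 + c) * |Z ω|) (n + 2 : ℕ) P := MemLp.add (memLp_const (1 : ℝ)) h0
  refine (integrable_abs_pow h1).mono' ?_ (ae_of_all _ fun ω => ?_)
  · have h2 : Continuous fun z : ℝ => z ^ 2 * (1 + c * |z|) ^ n := by fun_prop
    exact h2.comp_aestronglyMeasurable hZ.1
  · have h0 := abs_nonneg (Z ω)
    have h2 : 0 ≤ c * |Z ω| := by positivity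
    rw [Real.norm_eq_abs, abs_of_nonneg (by positivity), ← sq_abs (Z ω),
      abs_of_nonneg (by positivity : 0 ≤ 1 + (1 + c) * |Z ω|), pow_add, mul_comm]
    gcongr <;> linarith

/-- The constant `E[Z² (1 + √T |Z|)^n]` for a standard Gaussian `Z`. -/
noncomputable def gaussConst (n : ℕ) (T : ℝ≥0) : ℝ :=
  ∫ z, z ^ 2 * (1 + √(T : ℝ) * |z|) ^ n ∂(gaussianReal 0 1)

theorem gaussConst_nonneg (n : ℕ) (T : ℝ≥0) : 0 ≤ gaussConst n T :=
  integral_nonneg fun z => by positivity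

/-- Rescaling to a standard Gaussian extracts δ from z²; in the other factor √δ is bounded by √T, so
the constant is uniform over all steps. -/
theorem integral_gaussian_le (n : ℕ) {δ T : ℝ≥0} (hδ : δ ≤ T) :
    ∫ z, z ^ 2 * (1 + |z|) ^ n ∂(gaussianReal 0 δ) ≤ δ * gaussConst n T := by
  have hmap : (gaussianReal 0 1).map (fun x => √(δ : ℝ) * x) = gaussianReal 0 δ := by
    rw [gaussianReal_map_const_mul, mul_zero]
    congr 1
    ext
    simp
  have hL : MemLp (fun z : ℝ => z) ((n + 2 : ℕ) : ℝ≥0∞) (gaussianReal 0 1) := by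
    have h := memLp_id_gaussianReal (μ := 0) (v := 1) ((n + 2 : ℕ) : ℝ≥0)
    rw [ENNReal.coe_natCast] at h
    exact h
  rw [← hmap, integral_map (by fun_prop) (by fun_prop), gaussConst, ← integral_const_mul]
  refine integral_mono_of_nonneg (ae_of_all _ fun z => by positivity)
    ((integrable_sq_mul_pow hL (Real.sqrt_nonneg _)).const_mul _) (ae_of_all _ fun z => ?_)
  have h1 : √(δ : ℝ) ≤ √(T : ℝ) := Real.sqrt_le_sqrt (NNReal.coe_le_coe.2 hδ)
  dsimp only
  rw [mul_pow, Real.sq_sqrt (NNReal.coe_nonneg δ), abs_mul, abs_of_nonneg (Real.sqrt_nonneg _), mul_assoc]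
  gcongr

/-! ### One-step moment estimate under independence -/

section Step

variable {Ω : Type*} {m mΩ : MeasurableSpace Ω} {P : Measure Ω}

theorem indepFun_comp {Z X : Ω → ℝ}
    (hind : Indep (MeasurableSpace.comap Z inferInstance) m P) (hX : Measurable[m] X)
    {φ : ℝ → ℝ} (hφ : Measurable φ) : IndepFun X (fun ω => φ (Z ω)) P := by
  have h1 : IndepFun Z X P := by
    rw [IndepFun_iff_Indep]
    exact indep_of_indep_of_le_right hind hX.comap_le
  exact (h1.comp hφ measurable_id).symm

/-- By independence the product of q-th powers is integrable, so no integrability is lost and the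
exponent stays the same from step to step. -/
theorem memLp_mul_of_indep [IsFiniteMeasure P] {G Z : Ω → ℝ} {q : ℕ} (hq : q ≠ 0)
    (hind : Indep (MeasurableSpace.comap Z inferInstance) m P) (hG : Measurable[m] G)
    (hGL : MemLp G q P) (hZL : MemLp Z q P) : MemLp (fun ω => G ω * Z ω) q P := by
  refine (integrable_norm_rpow_iff (hGL.1.mul hZL.1) (by simpa using hq) (by simp)).1 ?_
  have hI : IndepFun (fun ω => |G ω| ^ q) (fun ω => |Z ω| ^ q) P :=
    indepFun_comp (X := fun ω => |G ω| ^ q) (φ := fun z => |z| ^ q) hind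
      ((continuous_abs.pow q).measurable.comp hG) (by fun_prop)
  refine (hI.integrable_mul (integrable_abs_pow hGL) (integrable_abs_pow hZL)).congr
    (ae_of_all _ fun ω => ?_)
  simp [mul_pow]

/-- The first order term has mean zero since Z is centred and independent of the past; only the
quadratic remainder is left. An even power makes the absolute value disappear, so the polynomial
expansion applies. -/
theorem integral_add_mul_pow_le [IsFiniteMeasure P] {M G Z : Ω → ℝ} {n : ℕ}
    (hind : Indep (MeasurableSpace.comap Z inferInstance) m P) (hM : Measurable[m] M)
    (hG : Measurable[m] G) (hML : MemLp M (n + 2 : ℕ) P) (hGL : MemLp G (n + 2 : ℕ) P)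
    (hZL : MemLp Z (n + 2 : ℕ) P) (hZ0 : ∫ ω, Z ω ∂P = 0) (hn : Even n) :
    ∫ ω, |M ω + G ω * Z ω| ^ (n + 2) ∂P ≤ ∫ ω, |M ω| ^ (n + 2) ∂P
      + (n + 2) ^ 2 * ((∫ ω, (|M ω| + |G ω|) ^ (n + 2) ∂P)
        * ∫ ω, Z ω ^ 2 * (1 + |Z ω|) ^ n ∂P) := by
  have hev : Even (n + 2) := hn.add even_two
  simp only [hev.pow_abs]
  have hMI : Integrable (fun ω => M ω ^ (n + 2)) P := by
    simpa only [hev.pow_abs] using integrable_abs_pow hML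
  have hSI : Integrable (fun ω => (|M ω| + |G ω|) ^ (n + 2)) P := by
    refine (integrable_abs_pow (hML.norm.add hGL.norm)).congr (ae_of_all _ fun ω => ?_)
    simp only [hev.pow_abs]
    rfl
  have hZI : Integrable (fun ω => Z ω ^ 2 * (1 + |Z ω|) ^ n) P := by
    simpa using integrable_sq_mul_pow hZL zero_le_one
  have hMG : Integrable (fun ω => M ω ^ (n + 1) * G ω) P := by
    refine integrable_of_abs_le_pow_mul ?_ hML hGL fun ω => ?_
    · exact (hML.1.pow _).mul hGL.1
    · rw [abs_mul, abs_pow]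
  have hZint : Integrable Z P := by
    refine hZL.integrable ?_
    exact_mod_cast (by omega : 1 ≤ n + 2)
  have i1 : IndepFun (fun ω => M ω ^ (n + 1) * G ω) Z P :=
    indepFun_comp (φ := id) hind ((hM.pow_const _).mul hG) measurable_id
  have hs : Measurable[m] fun ω => |M ω| + |G ω| :=
    (continuous_abs.measurable.comp hM).add (continuous_abs.measurable.comp hG)
  have i2 : IndepFun (fun ω => (|M ω| + |G ω|) ^ (n + 2))
      (fun ω => Z ω ^ 2 * (1 + |Z ω|) ^ n) P :=
    indepFun_comp (φ := fun z => z ^ 2 * (1 + |z|) ^ n) hind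
      (hs.pow_const _) (by fun_prop)
  have e1 : ∫ ω, M ω ^ (n + 1) * G ω * Z ω ∂P = 0 := by
    rw [i1.integral_fun_mul_eq_mul_integral hMG.1 hZint.1, hZ0, mul_zero]
  have e2 := i2.integral_fun_mul_eq_mul_integral hSI.1 hZI.1
  have I1 : Integrable (fun ω => M ω ^ (n + 1) * G ω * Z ω) P := i1.integrable_mul hMG hZint
  have I2 : Integrable
      (fun ω => (|M ω| + |G ω|) ^ (n + 2) * (Z ω ^ 2 * (1 + |Z ω|) ^ n)) P :=
    i2.integrable_mul hSI hZI
  have hL : MemLp (fun ω => M ω + G ω * Z ω) (n + 2 : ℕ) P :=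
    hML.add (memLp_mul_of_indep (by omega) hind hG hGL hZL)
  have hLI : Integrable (fun ω => (M ω + G ω * Z ω) ^ (n + 2)) P := by
    simpa only [hev.pow_abs] using integrable_abs_pow hL
  have key := integral_mono hLI
    ((hMI.add (I1.const_mul ((n : ℝ) + 2))).add (I2.const_mul (((n : ℝ) + 2) ^ 2)))
    fun ω => add_mul_pow_le (M ω) (G ω) (Z ω) n
  rw [integral_add' (hMI.add (I1.const_mul _)) (I2.const_mul _),
    integral_add' hMI (I1.const_mul _), integral_const_mul, integral_const_mul, e1, e2] at key
  simpa using key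

end Step

/-! ### Brownian increments -/

section Brownian

variable {Ω : Type*} {mΩ : MeasurableSpace Ω} {P : Measure Ω} {ℱ : Filtration ℝ≥0 mΩ}
  {B : ℝ≥0 → Ω → ℝ}

theorem IsFilteredBrownian.hasLaw_sub (hB : IsFilteredBrownian B ℱ P) {s t : ℝ≥0} (hst : s ≤ t) :
    HasLaw (fun ω => B t ω - B s ω) (gaussianReal 0 (t - s)) P := by
  have h := hB.isBrownian.hasLaw_sub t s
  have h2 : nndist t.1 s.1 = t - s := by
    ext
    rw [coe_nndist, Real.dist_eq, NNReal.coe_sub hst]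
    exact abs_of_nonneg (sub_nonneg.2 (NNReal.coe_le_coe.2 hst))
  rw [h2] at h
  exact h

theorem IsFilteredBrownian.memLp_sub (hB : IsFilteredBrownian B ℱ P) {s t : ℝ≥0} (hst : s ≤ t)
    (q : ℕ) : MemLp (fun ω => B t ω - B s ω) q P :=
  (hB.hasLaw_sub hst).hasGaussianLaw.memLp (by simp)

theorem IsFilteredBrownian.integral_sub_eq_zero (hB : IsFilteredBrownian B ℱ P) {s t : ℝ≥0}
    (hst : s ≤ t) : ∫ ω, B t ω - B s ω ∂P = 0 := by
  rw [(hB.hasLaw_sub hst).integral_eq, integral_id_gaussianReal]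

theorem IsFilteredBrownian.integral_sq_mul_le (hB : IsFilteredBrownian B ℱ P) {s t T : ℝ≥0}
    (hst : s ≤ t) (htT : t ≤ T) (n : ℕ) :
    ∫ ω, (B t ω - B s ω) ^ 2 * (1 + |B t ω - B s ω|) ^ n ∂P ≤ (t - s : ℝ) * gaussConst n T := by
  have h := (hB.hasLaw_sub hst).integral_comp (f := fun z => z ^ 2 * (1 + |z|) ^ n) (by fun_prop)
  have h2 := integral_gaussian_le n (tsub_le_self.trans htT : t - s ≤ T)
  rw [← h, NNReal.coe_sub hst] at h2
  exact h2

theorem IsFilteredBrownian.martingale [IsProbabilityMeasure P] (hB : IsFilteredBrownian B ℱ P) :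
    Martingale B ℱ P := by
  refine ⟨hB.adapted, fun s t hst => ?_⟩
  have hi := hB.isBrownian.integrable_eval
  have hsm : StronglyMeasurable fun ω => B t ω - B s ω :=
    ((hB.adapted t).mono (ℱ.le t)).sub ((hB.adapted s).mono (ℱ.le s))
  have h1 := condExp_indep_eq (hsm.measurable.comap_le) (ℱ.le s)
    (comap_measurable (fun ω => B t ω - B s ω)).stronglyMeasurable (hB.indep s t hst)
  have h2 : P[B s | ℱ s] = B s := condExp_of_stronglyMeasurable (ℱ.le s) (hB.adapted s) (hi s)
  have h3 := condExp_sub (hi t) (hi s) (ℱ s)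
  filter_upwards [h1, h3] with ω h1 h3
  rw [hB.integral_sub_eq_zero hst] at h1
  have h4 : P[B t - B s | ℱ s] ω = 0 := h1
  rw [h4, h2, Pi.sub_apply] at h3
  linarith

end Brownian

/-! ### Moments of elementary stochastic and drift integrals -/

section Elementary

variable {Ω : Type*} {mΩ : MeasurableSpace Ω} {P : Measure Ω} {ℱ : Filtration ℝ≥0 mΩ}
  {B : ℝ≥0 → Ω → ℝ}

theorem martingale_stopped [IsFiniteMeasure P] {M : ℝ≥0 → Ω → ℝ} (hM : Martingale M ℱ P)
    (c : ℝ≥0) : Martingale (fun t => M (min c t)) ℱ P := by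
  refine ⟨fun t => (hM.1 _).mono (ℱ.mono (min_le_right _ _)), fun s t hst => ?_⟩
  rcases le_total c s with h | h
  · dsimp only
    rw [min_eq_left h, min_eq_left (h.trans hst), condExp_of_stronglyMeasurable (ℱ.le s)
      ((hM.1 c).mono (ℱ.mono h)) (hM.integrable c)]
  · have := hM.2 s (min c t) (le_min h hst)
    dsimp only
    rwa [min_eq_right h]

/-- The process vanishes up to u, and from u on G can be pulled out of the conditional expectation.
For s ≤ u ≤ t the tower property through u joins the two regimes. -/
theorem martingale_mul_sub [IsFiniteMeasure P] {M : ℝ≥0 → Ω → ℝ} (hM : Martingale M ℱ P)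
    {u v : ℝ≥0} (huv : u ≤ v) {G : Ω → ℝ} (hG : StronglyMeasurable[ℱ u] G)
    (hint : ∀ t, Integrable (fun ω => G ω * (M (min v t) ω - M (min u t) ω)) P) :
    Martingale (fun t ω => G ω * (M (min v t) ω - M (min u t) ω)) ℱ P := by
  set N : ℝ≥0 → Ω → ℝ := (fun t => M (min v t)) - fun t => M (min u t) with hNdef
  have hN : Martingale N ℱ P := (martingale_stopped hM v).sub (martingale_stopped hM u)
  have hint' : ∀ t, Integrable (G * N t) P := hint
  change Martingale (fun t => G * N t) ℱ P
  have hzero : ∀ t ≤ u, G * N t = 0 := fun t ht => by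
    have : N t = 0 := by
      simp [hNdef, min_eq_right ht, min_eq_right (ht.trans huv)]
    rw [this, mul_zero]
  have key : ∀ s t, u ≤ s → s ≤ t → P[G * N t | ℱ s] =ᵐ[P] G * N s := fun s t hus hst => by
    have h1 := condExp_mul_of_stronglyMeasurable_left (μ := P) (hG.mono (ℱ.mono hus)) (hint' t)
      (hN.integrable t)
    filter_upwards [h1, hN.2 s t hst] with ω h1 h2
    rw [h1, Pi.mul_apply, h2, Pi.mul_apply]
  refine ⟨fun t => ?_, fun s t hst => ?_⟩
  · rcases le_total t u with h | h
    · change StronglyMeasurable[ℱ t] (G * N t)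
      rw [hzero t h]
      exact stronglyMeasurable_zero
    · exact (hG.mono (ℱ.mono h)).mul (hN.1 t)
  · rcases le_total u s with h | h
    · exact key s t h hst
    · dsimp only
      rw [hzero s h]
      rcases le_total t u with h' | h'
      · rw [hzero t h', condExp_zero]
      · have h1 := key u t le_rfl h'
        rw [hzero u le_rfl] at h1
        have h2 := condExp_condExp_of_le (μ := P) (f := G * N t) (ℱ.mono h) (ℱ.le u)
        have h3 := condExp_congr_ae (m := ℱ s) h1
        rw [condExp_zero] at h3
        exact h2.symm.trans h3

/-- The integral up to time `t` of the step process with value `G k` on `[τ k, τ (k + 1))`,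
`k < K`, against `B`. -/
noncomputable def elemInt (τ : ℕ → ℝ≥0) (K : ℕ) (G : ℕ → Ω → ℝ) (B : ℝ≥0 → Ω → ℝ) (t : ℝ≥0)
    (ω : Ω) : ℝ :=
  ∑ k ∈ Finset.range K, G k ω * (B (min (τ (k + 1)) t) ω - B (min (τ k) t) ω)

variable {τ : ℕ → ℝ≥0} {G : ℕ → Ω → ℝ}

theorem elemInt_of_le (hτ : Monotone τ) (k : ℕ) {t : ℝ≥0} (ht : τ k ≤ t) (ω : Ω) :
    elemInt τ k G B t ω = elemInt τ k G B (τ k) ω := by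
  refine Finset.sum_congr rfl fun i hi => ?_
  have h1 : τ (i + 1) ≤ τ k := hτ (Finset.mem_range.1 hi)
  have h2 : τ i ≤ τ k := hτ (Finset.mem_range.1 hi).le
  rw [min_eq_left h1, min_eq_left h2, min_eq_left (h1.trans ht), min_eq_left (h2.trans ht)]

theorem elemInt_succ (hτ : Monotone τ) (k : ℕ) (ω : Ω) :
    elemInt τ (k + 1) G B (τ (k + 1)) ω
      = elemInt τ k G B (τ k) ω + G k ω * (B (τ (k + 1)) ω - B (τ k) ω) := by
  rw [elemInt, Finset.sum_range_succ, min_self, min_eq_left (hτ k.le_succ)]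
  congr 1
  exact elemInt_of_le hτ k (hτ k.le_succ) ω

theorem continuous_elemInt (τ : ℕ → ℝ≥0) (K : ℕ) (G : ℕ → Ω → ℝ) {ω : Ω}
    (hB : Continuous fun t => B t ω) : Continuous fun t => elemInt τ K G B t ω := by
  have h : ∀ c, Continuous fun t => B (min c t) ω := fun c =>
    hB.comp (continuous_const.min continuous_id)
  exact continuous_finsetSum _ fun k _ => continuous_const.mul ((h _).sub (h _))

theorem memLp_elemInt_term [IsProbabilityMeasure P] (hB : IsFilteredBrownian B ℱ P) {u v : ℝ≥0}
    (huv : u ≤ v) {G : Ω → ℝ} (hG : Measurable[ℱ u] G) {q : ℕ} (hq : q ≠ 0) (hGL : MemLp G q P)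
    (t : ℝ≥0) : MemLp (fun ω => G ω * (B (min v t) ω - B (min u t) ω)) q P := by
  rcases le_total t u with h | h
  · simp [min_eq_right h, min_eq_right (h.trans huv)]
  · rw [min_eq_left h]
    exact memLp_mul_of_indep hq (hB.indep u _ (le_min huv h)) hG hGL
      (hB.memLp_sub (le_min huv h) q)

theorem memLp_elemInt [IsProbabilityMeasure P] (hB : IsFilteredBrownian B ℱ P) (hτ : Monotone τ)
    {K q : ℕ} (hq : q ≠ 0) (hG : ∀ k < K, Measurable[ℱ (τ k)] (G k))
    (hGL : ∀ k < K, MemLp (G k) q P) (t : ℝ≥0) : MemLp (elemInt τ K G B t) q P := by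
  have h := memLp_finsetSum (μ := P) (p := (q : ℝ≥0∞)) (Finset.range K)
    (f := fun k ω => G k ω * (B (min (τ (k + 1)) t) ω - B (min (τ k) t) ω)) fun k hk =>
      memLp_elemInt_term hB (hτ k.le_succ) (hG k (Finset.mem_range.1 hk)) hq
        (hGL k (Finset.mem_range.1 hk)) t
  exact h

theorem martingale_elemInt [IsProbabilityMeasure P] (hB : IsFilteredBrownian B ℱ P)
    (hτ : Monotone τ) {q : ℕ} (hq : q ≠ 0) : ∀ K, (∀ k < K, Measurable[ℱ (τ k)] (G k)) →
      (∀ k < K, MemLp (G k) q P) → Martingale (elemInt τ K G B) ℱ P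
  | 0, _, _ => by
    have : elemInt τ 0 G B = 0 := by
      funext t ω
      simp [elemInt]
    rw [this]
    exact martingale_zero ℝ ℱ P
  | K + 1, hG, hGL => by
    have h1 := martingale_elemInt hB hτ hq K (fun k hk => hG k (hk.trans K.lt_succ_self))
      (fun k hk => hGL k (hk.trans K.lt_succ_self))
    have h2 := martingale_mul_sub hB.martingale (hτ K.le_succ)
      (hG K K.lt_succ_self).stronglyMeasurable fun t =>
        (memLp_elemInt_term hB (hτ K.le_succ) (hG K K.lt_succ_self) hq
          (hGL K K.lt_succ_self) t).integrable (by exact_mod_cast Nat.one_le_iff_ne_zero.2 hq)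
    have h3 : elemInt τ (K + 1) G B = elemInt τ K G B
        + fun t ω => G K ω * (B (min (τ (K + 1)) t) ω - B (min (τ K) t) ω) := by
      funext t ω
      simp [elemInt, Finset.sum_range_succ]
    rw [h3]
    exact h1.add h2

theorem add_pow_le_two_pow {a b : ℝ} (ha : 0 ≤ a) (hb : 0 ≤ b) (q : ℕ) :
    (a + b) ^ q ≤ 2 ^ q * (a ^ q + b ^ q) := by
  refine (add_pow_le ha hb q).trans ?_
  have h : (2 : ℝ) ^ (q - 1) ≤ 2 ^ q := pow_le_pow_right₀ one_le_two (Nat.sub_le q 1)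
  gcongr

/-- Growth of the moments of the elementary integral over one step. -/
theorem integral_elemInt_succ_le [IsProbabilityMeasure P] (hB : IsFilteredBrownian B ℱ P)
    (hτ : Monotone τ) {T : ℝ≥0} {k n : ℕ} (hn : Even n) (hkT : τ (k + 1) ≤ T)
    (hG : ∀ i ≤ k, Measurable[ℱ (τ i)] (G i)) (hGL : ∀ i ≤ k, MemLp (G i) (n + 2 : ℕ) P) :
    ∫ ω, |elemInt τ (k + 1) G B (τ (k + 1)) ω| ^ (n + 2) ∂P
      ≤ ∫ ω, |elemInt τ k G B (τ k) ω| ^ (n + 2) ∂P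
        + (n + 2) ^ 2 * 2 ^ (n + 2) * gaussConst n T * ((τ (k + 1) - τ k : ℝ)
          * (∫ ω, |elemInt τ k G B (τ k) ω| ^ (n + 2) ∂P + ∫ ω, |G k ω| ^ (n + 2) ∂P)) := by
  have hk := hτ k.le_succ
  have hM : Measurable[ℱ (τ k)] (elemInt τ k G B (τ k)) :=
    ((martingale_elemInt hB hτ (q := n + 2) (by omega) k (fun i hi => hG i hi.le)
      (fun i hi => hGL i hi.le)).1 (τ k)).measurable
  have hML : MemLp (elemInt τ k G B (τ k)) (n + 2 : ℕ) P :=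
    memLp_elemInt hB hτ (by omega) (fun i hi => hG i hi.le) (fun i hi => hGL i hi.le) _
  simp only [elemInt_succ hτ]
  refine (integral_add_mul_pow_le (hB.indep _ _ hk) hM (hG k le_rfl) hML (hGL k le_rfl)
    (hB.memLp_sub hk _) (hB.integral_sub_eq_zero hk) hn).trans ?_
  have h1 := hB.integral_sq_mul_le hk hkT n
  have hI1 := integrable_abs_pow hML
  have hI2 := integrable_abs_pow (hGL k le_rfl)
  have h2 : ∫ ω, (|elemInt τ k G B (τ k) ω| + |G k ω|) ^ (n + 2) ∂P ≤ 2 ^ (n + 2)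
      * (∫ ω, |elemInt τ k G B (τ k) ω| ^ (n + 2) ∂P + ∫ ω, |G k ω| ^ (n + 2) ∂P) := by
    rw [← integral_add hI1 hI2, ← integral_const_mul]
    exact integral_mono_of_nonneg (ae_of_all _ fun ω => by positivity)
      ((hI1.add hI2).const_mul _)
      (ae_of_all _ fun ω => add_pow_le_two_pow (abs_nonneg _) (abs_nonneg _) _)
  have h3 : 0 ≤ ∫ ω, (B (τ (k + 1)) ω - B (τ k) ω) ^ 2
      * (1 + |B (τ (k + 1)) ω - B (τ k) ω|) ^ n ∂P := integral_nonneg fun ω => by positivity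
  have h4 : 0 ≤ 2 ^ (n + 2)
      * (∫ ω, |elemInt τ k G B (τ k) ω| ^ (n + 2) ∂P + ∫ ω, |G k ω| ^ (n + 2) ∂P) :=
    mul_nonneg (by positivity) (add_nonneg (integral_nonneg fun ω => by positivity)
      (integral_nonneg fun ω => by positivity))
  have h5 := mul_le_mul_of_nonneg_left (mul_le_mul h2 h1 h3 h4)
    (by positivity : (0 : ℝ) ≤ ((n : ℝ) + 2) ^ 2)
  linarith

theorem add_pow_sub_pow_le {x y : ℝ} (hx : 0 ≤ x) (hy : 0 ≤ y) : ∀ n : ℕ,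
    (x + y) ^ (n + 1) ≤ x ^ (n + 1) + (n + 1) * (y * (x + y) ^ n)
  | 0 => by simp
  | n + 1 => by
    have ih := mul_le_mul_of_nonneg_left (add_pow_sub_pow_le hx hy n) (add_nonneg hx hy)
    have h1 : x ^ (n + 1) ≤ (x + y) ^ (n + 1) := pow_le_pow_left₀ hx (by linarith) _
    have h2 := mul_le_mul_of_nonneg_left h1 hy
    have e1 : (x + y) * (x + y) ^ (n + 1) = (x + y) ^ (n + 1 + 1) := by ring
    have e2 : (x + y) * (x ^ (n + 1) + (n + 1) * (y * (x + y) ^ n))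
        = x ^ (n + 1 + 1) + y * x ^ (n + 1) + (n + 1) * (y * (x + y) ^ (n + 1)) := by ring
    push_cast
    linarith

/-- Growth of a power over one drift step. -/
theorem add_mul_pow_le_drift {x d c T : ℝ} (hx : 0 ≤ x) (hd : 0 ≤ d) (hdT : d ≤ T) (hc : 0 ≤ c)
    (n : ℕ) : (x + d * c) ^ (n + 1)
      ≤ x ^ (n + 1) + (n + 1) * (1 + T) ^ n * 2 ^ (n + 1) * (d * (x ^ (n + 1) + c ^ (n + 1))) := by
  have hT : 0 ≤ T := hd.trans hdT
  refine (add_pow_sub_pow_le hx (mul_nonneg hd hc) n).trans ?_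
  have h1 : x + d * c ≤ (1 + T) * (x + c) := by
    have := mul_le_mul_of_nonneg_right hdT hc
    nlinarith [mul_nonneg hT hx]
  have h2 : (x + d * c) ^ n ≤ (1 + T) ^ n * (x + c) ^ n := by
    rw [← mul_pow]
    gcongr
  have h3 : c * (x + c) ^ n ≤ (x + c) ^ (n + 1) := by
    rw [pow_succ, mul_comm]
    gcongr
    linarith
  have h4 := add_pow_le_two_pow hx hc (n + 1)
  have h5 : d * c * (x + d * c) ^ n
      ≤ (1 + T) ^ n * 2 ^ (n + 1) * (d * (x ^ (n + 1) + c ^ (n + 1))) :=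
    calc d * c * (x + d * c) ^ n ≤ d * c * ((1 + T) ^ n * (x + c) ^ n) := by gcongr
      _ = (1 + T) ^ n * d * (c * (x + c) ^ n) := by ring
      _ ≤ (1 + T) ^ n * d * (2 ^ (n + 1) * (x ^ (n + 1) + c ^ (n + 1))) :=
        mul_le_mul_of_nonneg_left (h3.trans h4) (by positivity)
      _ = _ := by ring
  have h6 := mul_le_mul_of_nonneg_left h5 (by positivity : (0 : ℝ) ≤ (n : ℝ) + 1)
  linarith

/-- The integral of the absolute value of the step process with value `F k` on
`[τ k, τ (k + 1))`, `k < K`. -/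
noncomputable def driftSum (τ : ℕ → ℝ≥0) (F : ℕ → Ω → ℝ) (K : ℕ) (ω : Ω) : ℝ :=
  ∑ k ∈ Finset.range K, (τ (k + 1) - τ k : ℝ) * |F k ω|

theorem driftSum_nonneg (hτ : Monotone τ) (F : ℕ → Ω → ℝ) (K : ℕ) (ω : Ω) :
    0 ≤ driftSum τ F K ω :=
  Finset.sum_nonneg fun k _ =>
    mul_nonneg (sub_nonneg.2 (NNReal.coe_le_coe.2 (hτ k.le_succ))) (abs_nonneg _)

theorem memLp_driftSum {F : ℕ → Ω → ℝ} {K : ℕ} {q : ℝ≥0∞} (hF : ∀ k < K, MemLp (F k) q P) :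
    MemLp (driftSum τ F K) q P := by
  have h := memLp_finsetSum (μ := P) (p := q) (Finset.range K)
    (f := fun k ω => (τ (k + 1) - τ k : ℝ) * |F k ω|) fun k hk =>
      (hF k (Finset.mem_range.1 hk)).norm.const_mul _
  exact h

theorem integral_driftSum_succ_le [IsFiniteMeasure P] (hτ : Monotone τ) {T : ℝ≥0} {k n : ℕ}
    (hkT : τ (k + 1) ≤ T) {F : ℕ → Ω → ℝ} (hF : ∀ i ≤ k, MemLp (F i) (n + 1 : ℕ) P) :
    ∫ ω, |driftSum τ F (k + 1) ω| ^ (n + 1) ∂P ≤ ∫ ω, |driftSum τ F k ω| ^ (n + 1) ∂P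
      + (n + 1) * (1 + T) ^ n * 2 ^ (n + 1) * ((τ (k + 1) - τ k : ℝ)
        * (∫ ω, |driftSum τ F k ω| ^ (n + 1) ∂P + ∫ ω, |F k ω| ^ (n + 1) ∂P)) := by
  have hI1 := integrable_abs_pow (memLp_driftSum (τ := τ) fun i (hi : i < k) => hF i hi.le)
  have hI2 := integrable_abs_pow (hF k le_rfl)
  have hk : (τ k : ℝ) ≤ τ (k + 1) := NNReal.coe_le_coe.2 (hτ k.le_succ)
  have hkT' : (τ (k + 1) : ℝ) - τ k ≤ T := by
    have : (τ (k + 1) : ℝ) ≤ T := NNReal.coe_le_coe.2 hkT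
    linarith [NNReal.coe_nonneg (τ k)]
  have hI3 : Integrable (fun ω => (n + 1) * (1 + (T : ℝ)) ^ n * 2 ^ (n + 1)
      * ((τ (k + 1) - τ k : ℝ) * (|driftSum τ F k ω| ^ (n + 1) + |F k ω| ^ (n + 1)))) P :=
    ((hI1.add hI2).const_mul _).const_mul _
  rw [← integral_add hI1 hI2, ← integral_const_mul, ← integral_const_mul,
    ← integral_add hI1 hI3]
  refine integral_mono_of_nonneg (ae_of_all _ fun ω => by positivity)
    (hI1.add hI3) (ae_of_all _ fun ω => ?_)
  have h := add_mul_pow_le_drift (driftSum_nonneg hτ F k ω) (sub_nonneg.2 hk) hkT'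
    (abs_nonneg (F k ω)) n
  have e : driftSum τ F (k + 1) ω = driftSum τ F k ω + (τ (k + 1) - τ k : ℝ) * |F k ω| :=
    Finset.sum_range_succ _ _
  dsimp only
  rw [abs_of_nonneg (driftSum_nonneg hτ F (k + 1) ω), e,
    abs_of_nonneg (driftSum_nonneg hτ F k ω)]
  exact h

end Elementary

/-! ### Pathwise bounds with a lower barrier only -/

theorem IsReflectedPath.upper_eq_zero {T : ℝ≥0} {α : ℝ} {w x u l : ℝ≥0 → ℝ}
    (h : IsReflectedPath T α ⊤ w x u l) {t : ℝ≥0} (ht : t ≤ T) : u t = 0 := by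
  have hsub : Set.Ioc 0 t ⊆ {s | s ≤ T ∧ (x s : WithTop ℝ) < ⊤} := fun s hs =>
    ⟨hs.2.trans ht, WithTop.coe_lt_top (x s)⟩
  have h1 := measure_mono_null hsub h.upper_flat
  rw [pathMeasure_Ioc h.upper_mono h.continuousOn_upper, ENNReal.ofReal_eq_zero, min_eq_left ht,
    min_eq_left zero_le, h.upper_zero, sub_zero] at h1
  have h2 := h.upper_mono (Set.mem_Iic.2 zero_le) (Set.mem_Iic.2 ht) (zero_le (a := t))
  rw [h.upper_zero] at h2
  exact h1.antisymm h2

/-- After the last visit s of x to α before t the lower term is constant, and at that visit it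
equals α - w s since the upper term vanishes. Without a visit it is still zero. Only flatness is
used, so no uniqueness of the reflected path is needed. -/
theorem IsReflectedPath.lower_le {T : ℝ≥0} {α : ℝ} {w x u l : ℝ≥0 → ℝ}
    (h : IsReflectedPath T α ⊤ w x u l) {t : ℝ≥0} (ht : t ≤ T) {c : ℝ} (hc : 0 ≤ c)
    (H : ∀ s ≤ t, α - w s ≤ c) : l t ≤ c := by
  have hα : ∀ s ≤ t, α ≤ x s := fun s hs => by
    have := h.mem s (hs.trans ht)
    rw [closure_openInterval (WithTop.coe_lt_top α)] at this
    exact this.1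
  have hflat : ∀ s ≤ t, (∀ r, s < r → r ≤ t → x r ≠ α) → l t ≤ l s := fun s hs hr => by
    have hsub : Set.Ioc s t ⊆ {r | r ≤ T ∧ α < x r} := fun r hr' =>
      ⟨hr'.2.trans ht, lt_of_le_of_ne (hα r hr'.2) (hr r hr'.1 hr'.2).symm⟩
    have h1 := measure_mono_null hsub h.lower_flat
    rwa [pathMeasure_Ioc h.lower_mono h.continuousOn_lower, ENNReal.ofReal_eq_zero,
      min_eq_left ht, min_eq_left (hs.trans ht), sub_nonpos] at h1
  set S : Set ℝ≥0 := Set.Icc 0 t ∩ x ⁻¹' {α}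
  have hScl : IsClosed S := (h.continuousOn.mono fun s hs => hs.2.trans ht).preimage_isClosed_of_isClosed
    isClosed_Icc isClosed_singleton
  have hS : IsCompact S := isCompact_Icc.of_isClosed_subset hScl Set.inter_subset_left
  rcases S.eq_empty_or_nonempty with hE | hne
  · refine (hflat 0 zero_le fun r _ hr hxr => ?_).trans (h.lower_zero.trans_le hc)
    exact Set.eq_empty_iff_forall_notMem.1 hE r ⟨⟨zero_le, hr⟩, hxr⟩
  · have hmem := hS.sSup_mem hne
    set s := sSup S
    refine (hflat s hmem.1.2 fun r hsr hr hxr => ?_).trans ?_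
    · exact (le_csSup hS.bddAbove ⟨⟨zero_le, hr⟩, hxr⟩).not_gt hsr
    · have h1 := h.eq s (hmem.1.2.trans ht)
      have h2 : x s = α := hmem.2
      rw [h.upper_eq_zero (hmem.1.2.trans ht), h2] at h1
      linarith [H s hmem.1.2]

/-- The barrier enters only through α ≤ x₀, which turns α - w into at most x₀ - w; the resulting
bound is the same for every N. -/
theorem IsReflectedPath.abs_path_le {T : ℝ≥0} {α x₀ : ℝ} {w x u l : ℝ≥0 → ℝ}
    (h : IsReflectedPath T α ⊤ w x u l) (hα : α ≤ x₀) {t : ℝ≥0} (ht : t ≤ T) {R : ℝ}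
    (hR : ∀ s ≤ t, |w s - x₀| ≤ R) : |x t| ≤ |x₀| + 2 * R := by
  have hR0 : 0 ≤ R := (abs_nonneg _).trans (hR t le_rfl)
  have hl := h.lower_le ht hR0 fun s hs => by linarith [(abs_le.1 (hR s hs)).1]
  have hl0 := h.lower_mono (Set.mem_Iic.2 zero_le) (Set.mem_Iic.2 ht) (zero_le (a := t))
  rw [h.lower_zero] at hl0
  rw [h.eq t ht, h.upper_eq_zero ht]
  have h1 := abs_le.1 (hR t le_rfl)
  have h2 := neg_abs_le x₀
  have h3 := le_abs_self x₀
  exact abs_le.2 ⟨by linarith, by linarith⟩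

/-! ### Supremum moments by a discrete Gronwall argument -/

section Moments

variable {Ω : Type*} {mΩ : MeasurableSpace Ω} {P : Measure Ω} {ℱ : Filtration ℝ≥0 mΩ}
  {B : ℝ≥0 → Ω → ℝ}

theorem one_add_add_pow_le {A m : ℝ} (hA : 0 ≤ A) (hm : 0 ≤ m) (q : ℕ) :
    (1 + A + m) ^ q ≤ 4 ^ q * (1 + A ^ q + m ^ q) := by
  have h1 := add_pow_le_two_pow (add_nonneg zero_le_one hA) hm q
  have h2 := add_pow_le_two_pow zero_le_one hA q
  rw [one_pow] at h2
  have h3 : (1 : ℝ) ≤ 2 ^ q := one_le_pow₀ one_le_two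
  have h4 : m ^ q ≤ 2 ^ q * m ^ q := le_mul_of_one_le_left (pow_nonneg hm q) h3
  have h5 : (4 : ℝ) ^ q = 2 ^ q * 2 ^ q := by rw [← mul_pow]; norm_num
  rw [h5, mul_assoc]
  refine h1.trans (mul_le_mul_of_nonneg_left ?_ (by positivity))
  linarith

theorem abs_pow_le_of_abs_le {y x₀ A m : ℝ} (hA : 0 ≤ A) (hm : 0 ≤ m)
    (h : |y| ≤ |x₀| + 2 * (A + m)) (q : ℕ) :
    |y| ^ q ≤ (8 * (1 + |x₀|)) ^ q * (1 + A ^ q + m ^ q) := by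
  have h1 : |y| ≤ 2 * (1 + |x₀|) * (1 + A + m) := by
    have := mul_nonneg (abs_nonneg x₀) (add_nonneg hA hm)
    nlinarith [abs_nonneg x₀]
  calc |y| ^ q ≤ (2 * (1 + |x₀|) * (1 + A + m)) ^ q := by gcongr
    _ = (2 * (1 + |x₀|)) ^ q * (1 + A + m) ^ q := mul_pow _ _ _
    _ ≤ (2 * (1 + |x₀|)) ^ q * (4 ^ q * (1 + A ^ q + m ^ q)) := by
      gcongr
      exact one_add_add_pow_le hA hm q
    _ = _ := by
      rw [← mul_assoc, ← mul_pow]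
      ring_nf

/-- The supremum moment of a path controlled by its drift and martingale parts. -/
theorem lintegral_iSup_le_of_path_bound [IsProbabilityMeasure P] (hB : IsFilteredBrownian B ℱ P)
    {τ : ℕ → ℝ≥0} (hτ : Monotone τ) {F G : ℕ → Ω → ℝ} {n k : ℕ}
    (hG : ∀ i < k, Measurable[ℱ (τ i)] (G i)) (hGL : ∀ i < k, MemLp (G i) (n + 2 : ℕ) P)
    (hFL : ∀ i < k, MemLp (F i) (n + 2 : ℕ) P) {ξ : ℝ≥0 → Ω → ℝ} {x₀ : ℝ}
    (hpath : ∀ᵐ ω ∂P, ∀ t ≤ τ k, ∀ m, (∀ s ≤ τ k, |elemInt τ k G B s ω| ≤ m) →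
      |ξ t ω| ≤ |x₀| + 2 * (driftSum τ F k ω + m)) :
    ∫⁻ ω, ⨆ t ∈ Set.Iic (τ k), ENNReal.ofReal (|ξ t ω| ^ (n + 2)) ∂P
      ≤ ENNReal.ofReal ((8 * (1 + |x₀|)) ^ (n + 2) * 4 ^ (n + 2)
        * (1 + ∫ ω, |driftSum τ F k ω| ^ (n + 2) ∂P
          + ∫ ω, |elemInt τ k G B (τ k) ω| ^ (n + 2) ∂P)) := by
  set c : ℝ := (8 * (1 + |x₀|)) ^ (n + 2) with hc
  have hc0 : 0 ≤ c := by positivity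
  have hq : n + 2 ≠ 0 := by omega
  have hcont : ∀ᵐ ω ∂P, Continuous fun t => elemInt τ k G B t ω :=
    hB.isBrownian.cont.mono fun ω hω => continuous_elemInt τ k G hω
  have hAI := integrable_abs_pow (memLp_driftSum (τ := τ) hFL)
  have hdoob := lintegral_iSup_abs_pow_le (martingale_elemInt hB hτ hq k hG hGL)
    (fun t => memLp_elemInt hB hτ hq hG hGL t) hcont (τ k)
  set S : Ω → ℝ≥0∞ := fun ω => ⨆ t ∈ Set.Iic (τ k),
    ENNReal.ofReal (|elemInt τ k G B t ω| ^ (n + 2)) with hS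
  have hE0 : 0 ≤ ∫ ω, |driftSum τ F k ω| ^ (n + 2) ∂P := integral_nonneg fun ω => by positivity
  have hE1 : 0 ≤ ∫ ω, |elemInt τ k G B (τ k) ω| ^ (n + 2) ∂P :=
    integral_nonneg fun ω => by positivity
  have hI : Integrable (fun ω => c * (1 + |driftSum τ F k ω| ^ (n + 2))) P :=
    ((integrable_const 1).add hAI).const_mul c
  have hpt : ∀ᵐ ω ∂P, ⨆ t ∈ Set.Iic (τ k), ENNReal.ofReal (|ξ t ω| ^ (n + 2))
      ≤ ENNReal.ofReal (c * (1 + |driftSum τ F k ω| ^ (n + 2))) + ENNReal.ofReal c * S ω := by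
    filter_upwards [hpath, hcont] with ω h1 h2
    -- The maximiser of the martingale part turns the pathwise bound, stated for an arbitrary
    -- majorant m, into one by the supremum that Doob's inequality controls.
    obtain ⟨s₀, hs₀, hmax⟩ := (isCompact_Icc (a := (0 : ℝ≥0)) (b := τ k)).exists_isMaxOn
      (Set.nonempty_Icc.2 zero_le) h2.abs.continuousOn
    have hA := driftSum_nonneg hτ F k ω
    refine iSup₂_le fun t ht => ?_
    have h3 := abs_pow_le_of_abs_le hA (abs_nonneg _)
      (h1 t ht |elemInt τ k G B s₀ ω| fun s hs => hmax ⟨zero_le, hs⟩) (n + 2)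
    calc ENNReal.ofReal (|ξ t ω| ^ (n + 2))
        ≤ ENNReal.ofReal (c * (1 + |driftSum τ F k ω| ^ (n + 2))
          + c * |elemInt τ k G B s₀ ω| ^ (n + 2)) := by
          refine ENNReal.ofReal_le_ofReal (h3.trans_eq ?_)
          rw [abs_of_nonneg hA]
          ring
      _ = ENNReal.ofReal (c * (1 + |driftSum τ F k ω| ^ (n + 2)))
          + ENNReal.ofReal c * ENNReal.ofReal (|elemInt τ k G B s₀ ω| ^ (n + 2)) := by
          rw [ENNReal.ofReal_add (by positivity) (by positivity), ENNReal.ofReal_mul hc0 (q := _ ^ _)]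
      _ ≤ _ := by
          gcongr
          exact le_iSup₂ (f := fun t (_ : t ∈ Set.Iic (τ k)) =>
            ENNReal.ofReal (|elemInt τ k G B t ω| ^ (n + 2))) s₀ hs₀.2
  refine (lintegral_mono_ae hpt).trans ?_
  rw [lintegral_add_left' hI.1.aemeasurable.ennreal_ofReal, lintegral_const_mul' _ _
    ENNReal.ofReal_ne_top, ← ofReal_integral_eq_lintegral_ofReal hI
    (ae_of_all _ fun ω => by positivity), integral_const_mul,
    integral_add (integrable_const 1) hAI, integral_const, probReal_univ, one_smul]
  refine (add_le_add le_rfl (mul_le_mul_right hdoob _)).trans ?_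
  rw [← ENNReal.ofReal_mul hc0, ← ENNReal.ofReal_add (by positivity) (by positivity)]
  refine ENNReal.ofReal_le_ofReal ?_
  have h4 : (1 : ℝ) ≤ 4 ^ (n + 2) := one_le_pow₀ (by norm_num)
  have h5 : c * (1 + ∫ ω, |driftSum τ F k ω| ^ (n + 2) ∂P)
      ≤ c * 4 ^ (n + 2) * (1 + ∫ ω, |driftSum τ F k ω| ^ (n + 2) ∂P) := by
    gcongr
    exact le_mul_of_one_le_right hc0 h4
  linarith

theorem memLp_of_lintegral_iSup_le {X : Ω → ℝ} (hX : AEStronglyMeasurable X P) {q : ℕ}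
    (hq : q ≠ 0) {c : ℝ} (hc : 0 ≤ c)
    (h : ∫⁻ ω, ENNReal.ofReal (|X ω| ^ q) ∂P ≤ ENNReal.ofReal c) :
    MemLp X q P ∧ ∫ ω, |X ω| ^ q ∂P ≤ c := by
  have hm : AEStronglyMeasurable (fun ω => |X ω| ^ q) P := by
    have h2 : Continuous fun z : ℝ => |z| ^ q := by fun_prop
    exact h2.comp_aestronglyMeasurable hX
  have h0 : 0 ≤ᵐ[P] fun ω => |X ω| ^ q := ae_of_all _ fun ω => by positivity
  have hI : Integrable (fun ω => |X ω| ^ q) P :=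
    ⟨hm, (hasFiniteIntegral_iff_ofReal h0).2 (h.trans_lt ENNReal.ofReal_lt_top)⟩
  constructor
  · refine (integrable_norm_rpow_iff hX (by simpa using hq) (by simp)).1 ?_
    simpa using hI
  · rwa [← ofReal_integral_eq_lintegral_ofReal hI h0, ENNReal.ofReal_le_ofReal_iff hc] at h

theorem memLp_comp_of_growth [IsProbabilityMeasure P] {X : Ω → ℝ} {q : ℕ} (hX : MemLp X q P)
    {f : ℝ → ℝ} (hf : Continuous f) {c : ℝ} (hc : 0 ≤ c) (hg : ∀ x, |f x| ≤ c * (1 + |x|)) :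
    MemLp (fun ω => f (X ω)) q P ∧
      ∫ ω, |f (X ω)| ^ q ∂P ≤ c ^ q * 2 ^ q * (1 + ∫ ω, |X ω| ^ q ∂P) := by
  have h0 : MemLp (fun ω => 1 + |X ω|) q P := MemLp.add (memLp_const (1 : ℝ)) hX.norm
  have hI := integrable_abs_pow hX
  refine ⟨(h0.const_mul c).of_le (hf.comp_aestronglyMeasurable hX.1)
    (ae_of_all _ fun ω => (hg (X ω)).trans (le_abs_self _)), ?_⟩
  have h1 : ∫ ω, (1 + |X ω| ^ q) ∂P = 1 + ∫ ω, |X ω| ^ q ∂P := by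
    rw [integral_add (integrable_const 1) hI, integral_const, probReal_univ, one_smul]
  have hI2 : Integrable (fun ω => 1 + |X ω| ^ q) P := (integrable_const 1).add hI
  rw [← h1, ← integral_const_mul]
  refine integral_mono_of_nonneg (ae_of_all _ fun ω => by positivity) (hI2.const_mul _)
    (ae_of_all _ fun ω => ?_)
  have h2 := add_pow_le_two_pow zero_le_one (abs_nonneg (X ω)) q
  rw [one_pow] at h2
  calc |f (X ω)| ^ q ≤ (c * (1 + |X ω|)) ^ q := by gcongr; exact hg _
    _ = c ^ q * (1 + |X ω|) ^ q := mul_pow _ _ _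
    _ ≤ c ^ q * (2 ^ q * (1 + |X ω| ^ q)) := by gcongr
    _ = _ := by ring

/-- The constant in front of the exponential in the moment bound. -/
noncomputable def supConst (x₀ : ℝ) (q : ℕ) : ℝ := (8 * (1 + |x₀|)) ^ q * 4 ^ q

/-- The growth constant over one step in the moment bound. -/
noncomputable def stepConst (n : ℕ) (T : ℝ≥0) : ℝ :=
  (n + 2) ^ 2 * 2 ^ (n + 2) * gaussConst n T + (n + 2) * (1 + T) ^ (n + 1) * 2 ^ (n + 2)

/-- The exponential rate in the moment bound. -/
noncomputable def rateConst (n : ℕ) (T : ℝ≥0) (x₀ cf cg : ℝ) : ℝ :=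
  stepConst n T * (1 + (cf ^ (n + 2) + cg ^ (n + 2)) * 2 ^ (n + 2) * (1 + supConst x₀ (n + 2)))

theorem lintegral_iSup_abs_pow_le_exp [IsProbabilityMeasure P] (hB : IsFilteredBrownian B ℱ P)
    {τ : ℕ → ℝ≥0} (hτ : Monotone τ) (hτ0 : τ 0 = 0) {T : ℝ≥0} (hτT : ∀ k, τ k ≤ T)
    {ξ : ℝ≥0 → Ω → ℝ} (hξ : ∀ k, Measurable[ℱ (τ k)] (ξ (τ k))) {f g : ℝ → ℝ}
    (hf : Continuous f) (hg : Continuous g) {cf cg : ℝ} (hcf : 0 ≤ cf) (hcg : 0 ≤ cg)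
    (hfg : ∀ x, |f x| ≤ cf * (1 + |x|)) (hgg : ∀ x, |g x| ≤ cg * (1 + |x|)) {n : ℕ}
    (hn : Even n) {x₀ : ℝ}
    (hpath : ∀ k, ∀ᵐ ω ∂P, ∀ t ≤ τ k, ∀ m,
      (∀ s ≤ τ k, |elemInt τ k (fun i ω => g (ξ (τ i) ω)) B s ω| ≤ m) →
      |ξ t ω| ≤ |x₀| + 2 * (driftSum τ (fun i ω => f (ξ (τ i) ω)) k ω + m)) (k : ℕ) :
    ∫⁻ ω, ⨆ t ∈ Set.Iic (τ k), ENNReal.ofReal (|ξ t ω| ^ (n + 2)) ∂P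
      ≤ ENNReal.ofReal (supConst x₀ (n + 2)
        * Real.exp (rateConst n T x₀ cf cg * τ k)) := by
  set F : ℕ → Ω → ℝ := fun i ω => f (ξ (τ i) ω) with hF
  set G : ℕ → Ω → ℝ := fun i ω => g (ξ (τ i) ω) with hG
  set v : ℕ → ℝ := fun k => 1 + ∫ ω, |driftSum τ F k ω| ^ (n + 2) ∂P
    + ∫ ω, |elemInt τ k G B (τ k) ω| ^ (n + 2) ∂P with hv
  set D := supConst x₀ (n + 2) with hD
  set R := rateConst n T x₀ cf cg with hR
  have hD0 : 0 ≤ D := by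
    rw [hD, supConst]
    positivity
  have hv1 : ∀ k, 1 ≤ v k := fun k => by
    have h1 : 0 ≤ ∫ ω, |driftSum τ F k ω| ^ (n + 2) ∂P := integral_nonneg fun ω => by positivity
    have h2 : 0 ≤ ∫ ω, |elemInt τ k G B (τ k) ω| ^ (n + 2) ∂P :=
      integral_nonneg fun ω => by positivity
    simp only [hv]
    linarith
  have hGm : ∀ i, Measurable[ℱ (τ i)] (G i) := fun i => hg.measurable.comp (hξ i)
  have hsup : ∀ k, (∀ i < k, MemLp (ξ (τ i)) (n + 2 : ℕ) P) →
      ∫⁻ ω, ⨆ t ∈ Set.Iic (τ k), ENNReal.ofReal (|ξ t ω| ^ (n + 2)) ∂P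
        ≤ ENNReal.ofReal (D * v k) := fun k hk =>
    lintegral_iSup_le_of_path_bound hB hτ (fun i _ => hGm i)
      (fun i hi => (memLp_comp_of_growth (hk i hi) hg hcg hgg).1)
      (fun i hi => (memLp_comp_of_growth (hk i hi) hf hcf hfg).1) (hpath k)
  have hmem : ∀ k, (∀ i < k, MemLp (ξ (τ i)) (n + 2 : ℕ) P) →
      MemLp (ξ (τ k)) (n + 2 : ℕ) P ∧ ∫ ω, |ξ (τ k) ω| ^ (n + 2) ∂P ≤ D * v k := fun k hk =>
    memLp_of_lintegral_iSup_le (((hξ k).mono (ℱ.le _) le_rfl).aestronglyMeasurable) (by omega)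
      (mul_nonneg hD0 (zero_le_one.trans (hv1 k)))
      ((lintegral_mono fun ω => le_iSup₂ (f := fun t (_ : t ∈ Set.Iic (τ k)) =>
        ENNReal.ofReal (|ξ t ω| ^ (n + 2))) (τ k) (Set.mem_Iic.2 le_rfl)).trans (hsup k hk))
  -- No moment of the scheme is known in advance: integrability at earlier grid times gives a finite
  -- supremum bound at the next, and so its integrability.
  have hall : ∀ k, ∀ i < k, MemLp (ξ (τ i)) (n + 2 : ℕ) P := fun k => by
    induction k with
    | zero => exact fun i hi => absurd hi (Nat.not_lt_zero i)
    | succ k ih =>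
      intro i hi
      rcases Nat.lt_succ_iff_lt_or_eq.1 hi with h | rfl
      · exact ih i h
      · exact (hmem i ih).1
  have hstep : ∀ k, v (k + 1) ≤ v k * (1 + R * (τ (k + 1) - τ k)) := fun k => by
    have hLk : ∀ i ≤ k, MemLp (ξ (τ i)) (n + 2 : ℕ) P := fun i hi =>
      hall (k + 1) i (Nat.lt_succ_of_le hi)
    have h1 := integral_elemInt_succ_le hB hτ hn (hτT (k + 1)) (fun i _ => hGm i)
      (fun i hi => (memLp_comp_of_growth (hLk i hi) hg hcg hgg).1)
    have h2 := integral_driftSum_succ_le (n := n + 1) hτ (hτT (k + 1))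
      (fun i hi => (memLp_comp_of_growth (hLk i hi) hf hcf hfg).1)
    have h3 := (memLp_comp_of_growth (hLk k le_rfl) hg hcg hgg).2
    have h4 := (memLp_comp_of_growth (hLk k le_rfl) hf hcf hfg).2
    have h5 := (hmem k (hall k)).2
    have hd : (0 : ℝ) ≤ τ (k + 1) - τ k := sub_nonneg.2 (NNReal.coe_le_coe.2 (hτ k.le_succ))
    set e := ∫ ω, |elemInt τ k G B (τ k) ω| ^ (n + 2) ∂P
    set A := ∫ ω, |driftSum τ F k ω| ^ (n + 2) ∂P
    set EG := ∫ ω, |g (ξ (τ k) ω)| ^ (n + 2) ∂P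
    set EF := ∫ ω, |f (ξ (τ k) ω)| ^ (n + 2) ∂P
    set X := ∫ ω, |ξ (τ k) ω| ^ (n + 2) ∂P
    set d : ℝ := τ (k + 1) - τ k
    have he : 0 ≤ e := integral_nonneg fun ω => by positivity
    have hA : 0 ≤ A := integral_nonneg fun ω => by positivity
    have hEG : 0 ≤ EG := integral_nonneg fun ω => by positivity
    have hEF : 0 ≤ EF := integral_nonneg fun ω => by positivity
    have hvk : v k = 1 + A + e := rfl
    have hgc := gaussConst_nonneg n T
    set γ : ℝ := (cf ^ (n + 2) + cg ^ (n + 2)) * 2 ^ (n + 2) with hγ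
    have hγ0 : 0 ≤ γ := by positivity
    -- This closes the loop: linear growth bounds the coefficients by the position, and the position
    -- is bounded by D times `v k`.
    have h6 : EF + EG ≤ γ * (1 + D) * v k := by
      have h61 : EF + EG ≤ γ * (1 + X) := by rw [hγ]; linarith
      have h62 : γ * (1 + X) ≤ γ * ((1 + D) * v k) := by
        refine mul_le_mul_of_nonneg_left ?_ hγ0
        linarith [hv1 k]
      linarith
    set c1 : ℝ := (n + 2) ^ 2 * 2 ^ (n + 2) * gaussConst n T with hc1
    set c2 : ℝ := (n + 2) * (1 + T) ^ (n + 1) * 2 ^ (n + 2) with hc2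
    have hc10 : 0 ≤ c1 := by positivity
    have hc20 : 0 ≤ c2 := by positivity
    have h2' : ∫ ω, |driftSum τ F (k + 1) ω| ^ (n + 2) ∂P ≤ A + c2 * (d * (A + EF)) := by
      refine h2.trans_eq ?_
      rw [hc2]
      push_cast
      ring
    have h7 : v (k + 1) ≤ v k + (c1 + c2) * d * (v k + (EF + EG)) := by
      have e1 : v (k + 1) ≤ 1 + (A + c2 * (d * (A + EF))) + (e + c1 * (d * (e + EG))) :=
        add_le_add (add_le_add le_rfl h2') h1
      have e2 : c2 * (d * (A + EF)) ≤ c2 * (d * (v k + (EF + EG))) :=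
        mul_le_mul_of_nonneg_left (mul_le_mul_of_nonneg_left (by linarith) hd) hc20
      have e3 : c1 * (d * (e + EG)) ≤ c1 * (d * (v k + (EF + EG))) :=
        mul_le_mul_of_nonneg_left (mul_le_mul_of_nonneg_left (by linarith) hd) hc10
      linarith
    have h8 : (c1 + c2) * d * (v k + (EF + EG)) ≤ (c1 + c2) * d * (v k + γ * (1 + D) * v k) := by
      gcongr
    have h9 : R = (c1 + c2) * (1 + γ * (1 + D)) := rfl
    rw [h9]
    linarith
  have hexp : ∀ k, v k ≤ Real.exp (R * τ k) := fun k => by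
    induction k with
    | zero => simp [hv, driftSum, elemInt, hτ0]
    | succ k ih =>
      have hd : 0 ≤ v k := zero_le_one.trans (hv1 k)
      have h1 : 1 + R * (τ (k + 1) - τ k : ℝ) ≤ Real.exp (R * (τ (k + 1) - τ k)) := by
        linarith [Real.add_one_le_exp (R * (τ (k + 1) - τ k : ℝ))]
      -- Non-negativity of 1 + R(τ (k+1) - τ k) is read off from 0 ≤ v (k+1) and v k > 0, which
      -- avoids determining the sign of R.
      calc v (k + 1) ≤ v k * (1 + R * (τ (k + 1) - τ k)) := hstep k
        _ ≤ Real.exp (R * τ k) * Real.exp (R * (τ (k + 1) - τ k)) :=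
          mul_le_mul ih h1 (nonneg_of_mul_nonneg_right ((zero_le_one.trans (hv1 (k + 1))).trans
            (hstep k)) (zero_lt_one.trans_le (hv1 k))) (Real.exp_pos _).le
        _ = Real.exp (R * τ (k + 1)) := by
          rw [← Real.exp_add]
          ring_nf
  exact (hsup k (hall k)).trans (ENNReal.ofReal_le_ofReal
    (mul_le_mul_of_nonneg_left (hexp k) hD0))

end Moments

/-! ### The scheme on the stopped grid -/

theorem gridSum_eq_stopped {Δ T t : ℝ≥0} {k : ℕ} (ht : t ≤ T) {c c' : ℕ → ℝ}
    (A : ℝ≥0 → ℝ) (hc : ∀ i : ℕ, i * Δ < t → c i = c' i) :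
    gridSum Δ k c A t = ∑ i ∈ Finset.range k,
      c' i * (A (min (min (((i + 1 : ℕ) : ℝ≥0) * Δ) T) t) - A (min (min ((i : ℝ≥0) * Δ) T) t)) := by
  rw [gridSum_congr k hc fun _ _ => rfl]
  refine Finset.sum_congr rfl fun i _ => ?_
  rw [min_assoc, min_assoc, min_eq_right ht]

theorem abs_sum_drift_le {τ : ℕ → ℝ≥0} (hτ : Monotone τ) (c : ℕ → ℝ) (k : ℕ) (t : ℝ≥0) :
    |∑ i ∈ Finset.range k, c i * (((min (τ (i + 1)) t : ℝ≥0) : ℝ) - (min (τ i) t : ℝ≥0))|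
      ≤ ∑ i ∈ Finset.range k, (τ (i + 1) - τ i : ℝ) * |c i| := by
  refine (Finset.abs_sum_le_sum_abs _ _).trans (Finset.sum_le_sum fun i _ => ?_)
  have h0 : (τ i : ℝ) ≤ τ (i + 1) := NNReal.coe_le_coe.2 (hτ i.le_succ)
  rw [abs_mul, mul_comm]
  refine mul_le_mul_of_nonneg_right ?_ (abs_nonneg _)
  push_cast
  rw [abs_le]
  rcases min_cases (τ (i + 1) : ℝ) (t : ℝ) with h1 | h1 <;>
    rcases min_cases (τ i : ℝ) (t : ℝ) with h2 | h2 <;> constructor <;> linarith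

theorem mem_closure_domainN {a : ℝ} {b : WithTop ℝ} {N : ℕ} {x₀ : ℝ} (hx : x₀ ∈ domainN a b N)
    {x : ℝ} : x ∈ closure (domainN a b N) ↔
      a + 1 / (N : ℝ) ≤ x ∧ (x : WithTop ℝ) ≤ upperBarrier b N := by
  rw [domainN, closure_openInterval ((WithTop.coe_lt_coe.2 hx.1).trans hx.2)]
  rfl

theorem closure_domainN_subset {a : ℝ} {b : WithTop ℝ} {N : ℕ} (hN : 1 ≤ N) {x₀ : ℝ}
    (hx : x₀ ∈ domainN a b N) : closure (domainN a b N) ⊆ openInterval a b := by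
  intro x h
  rw [mem_closure_domainN hx] at h
  have hN' : (0 : ℝ) < 1 / N := by positivity
  refine ⟨by linarith [h.1], ?_⟩
  induction b using WithTop.recTopCoe with
  | top => exact WithTop.coe_lt_top x
  | coe b =>
    have h2 : x ≤ b - 1 / N := WithTop.coe_le_coe.1 h.2
    exact WithTop.coe_lt_coe.2 (by linarith)

theorem mem_domainN_of_mem {a : ℝ} {b : WithTop ℝ} {N : ℕ} (hN : 1 ≤ N) {x₀ : ℝ}
    (hx : x₀ ∈ domainN a b 1) : x₀ ∈ domainN a b N := by
  have hN' : 1 / (N : ℝ) ≤ 1 := by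
    rw [div_le_one (by positivity)]
    exact_mod_cast hN
  have h1 : a + 1 / ((1 : ℕ) : ℝ) < x₀ := hx.1
  rw [Nat.cast_one, div_one] at h1
  refine ⟨by rw [lowerBarrier]; linarith, ?_⟩
  induction b using WithTop.recTopCoe with
  | top => exact WithTop.coe_lt_top x₀
  | coe b =>
    have h2 : x₀ < b - 1 / ((1 : ℕ) : ℝ) := WithTop.coe_lt_coe.1 hx.2
    rw [Nat.cast_one, div_one] at h2
    exact WithTop.coe_lt_coe.2 (by linarith)

/-- Expanding around x₀, where the values of the coefficients are bounded, keeps the growth constant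
independent of the domain. -/
theorem abs_le_growth_of_lipschitz {f : ℝ → ℝ} {L K : ℝ≥0} (hf : LipschitzWith L f) {x₀ : ℝ}
    (hK : |f x₀| ≤ K) (x : ℝ) : |f x| ≤ (K + L * (1 + |x₀|)) * (1 + |x|) := by
  have h1 := hf.dist_le_mul x x₀
  rw [Real.dist_eq, Real.dist_eq] at h1
  have h2 : |f x| ≤ |f x - f x₀| + |f x₀| := by
    simpa using abs_add_le (f x - f x₀) (f x₀)
  have h3 : |x - x₀| ≤ (1 + |x₀|) * (1 + |x|) := by
    refine (abs_sub x x₀).trans ?_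
    nlinarith [abs_nonneg x, abs_nonneg x₀, mul_nonneg (abs_nonneg x) (abs_nonneg x₀)]
  have h4 : (L : ℝ) * |x - x₀| ≤ L * ((1 + |x₀|) * (1 + |x|)) := by gcongr
  have h5 : (K : ℝ) ≤ K * (1 + |x|) :=
    le_mul_of_one_le_right K.2 (by linarith [abs_nonneg x])
  linarith

section

variable {Ω : Type*} {mΩ : MeasurableSpace Ω} {P : Measure Ω} {ℱ : Filtration ℝ≥0 mΩ}
  {B : ℝ≥0 → Ω → ℝ} {T : ℝ≥0} {f g : ℝ → ℝ} {x₀ a : ℝ} {b : WithTop ℝ} {N : ℕ} {Δ : ℝ≥0}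
  {ξ U L : ℝ≥0 → Ω → ℝ}

theorem IsScheme.supMoment_le_of_finite [IsProbabilityMeasure P] {β : ℝ}
    (h : IsScheme P ℱ B T f g x₀ a β N Δ ξ U L) (hx : x₀ ∈ domainN a β N) {p : ℝ} (hp : 0 ≤ p) :
    supMoment P T p ξ ≤ ENNReal.ofReal (max (|a| ^ p) (|β| ^ p)) := by
  have hpt : ∀ᵐ ω ∂P, ⨆ t ∈ Set.Iic T, ENNReal.ofReal (|ξ t ω| ^ p)
      ≤ ENNReal.ofReal (max (|a| ^ p) (|β| ^ p)) := by
    filter_upwards [h.reflected] with ω hω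
    refine iSup₂_le fun t ht => ENNReal.ofReal_le_ofReal ?_
    obtain ⟨h1, h2⟩ := (mem_closure_domainN hx).1 (hω.mem t ht)
    replace h2 : ξ t ω ≤ β - 1 / N := WithTop.coe_le_coe.1 h2
    have hN' : (0 : ℝ) ≤ 1 / N := by positivity
    rcases le_total 0 (ξ t ω) with h0 | h0
    · refine le_max_of_le_right (Real.rpow_le_rpow (abs_nonneg _) ?_ hp)
      rw [abs_of_nonneg h0]
      linarith [le_abs_self β]
    · refine le_max_of_le_left (Real.rpow_le_rpow (abs_nonneg _) ?_ hp)
      rw [abs_of_nonpos h0]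
      linarith [neg_abs_le a]
  refine (lintegral_mono_ae hpt).trans ?_
  simp

/-- On the grid stopped at T the driver minus x₀ is a drift sum plus an elementary integral. The
grid values lie in cl D_N, so the global coefficients `f'` and `g'` may be used. -/
theorem IsScheme.path_bound (h : IsScheme P ℱ B T f g x₀ a ⊤ N Δ ξ U L) (hΔ : 0 < Δ)
    (hx : x₀ ∈ domainN a ⊤ N) {f' g' : ℝ → ℝ} (hf : Set.EqOn f f' (closure (domainN a ⊤ N)))
    (hg : Set.EqOn g g' (closure (domainN a ⊤ N))) (k : ℕ) :
    ∀ᵐ ω ∂P, ∀ t ≤ min ((k : ℝ≥0) * Δ) T, ∀ m,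
      (∀ s ≤ min ((k : ℝ≥0) * Δ) T, |elemInt (fun i => min ((i : ℝ≥0) * Δ) T) k
        (fun i ω => g' (ξ (min ((i : ℝ≥0) * Δ) T) ω)) B s ω| ≤ m) →
      |ξ t ω| ≤ |x₀| + 2 * (driftSum (fun i => min ((i : ℝ≥0) * Δ) T)
        (fun i ω => f' (ξ (min ((i : ℝ≥0) * Δ) T) ω)) k ω + m) := by
  have hτ : Monotone fun i : ℕ => min ((i : ℝ≥0) * Δ) T := fun i j hij => by
    dsimp only
    gcongr
  filter_upwards [h.reflected] with ω hω t ht m hm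
  refine hω.abs_path_le hx.1.le (ht.trans (min_le_right _ _)) fun s hs => ?_
  have hsT : s ≤ T := hs.trans (ht.trans (min_le_right _ _))
  have hsk : s ≤ k * Δ := hs.trans (ht.trans (min_le_left _ _))
  have hgrid : ∀ i : ℕ, i * Δ < s → ξ (i * Δ) ω = ξ (min ((i : ℝ≥0) * Δ) T) ω ∧
      ξ (i * Δ) ω ∈ closure (domainN a ⊤ N) := fun i hi => by
    have hiT : (i : ℝ≥0) * Δ ≤ T := hi.le.trans hsT
    exact ⟨by rw [min_eq_left hiT], hω.mem _ hiT⟩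
  rw [driver_eq hΔ hsk,
    gridSum_eq_stopped (c' := fun i => f' (ξ (min ((i : ℝ≥0) * Δ) T) ω)) hsT _
      fun i hi => by rw [hf (hgrid i hi).2, (hgrid i hi).1],
    gridSum_eq_stopped (c' := fun i => g' (ξ (min ((i : ℝ≥0) * Δ) T) ω)) hsT _
      fun i hi => by rw [hg (hgrid i hi).2, (hgrid i hi).1]]
  have h1 := abs_sum_drift_le hτ (fun i => f' (ξ (min ((i : ℝ≥0) * Δ) T) ω)) k s
  have h2 := hm s (hs.trans ht)
  rw [add_assoc, add_sub_cancel_left]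
  exact (abs_add_le _ _).trans (add_le_add h1 h2)

/-- The bound on the supremum moment for an infinite right endpoint. -/
noncomputable def momentConst (n : ℕ) (T Lf Lg Kf Kg : ℝ≥0) (x₀ : ℝ) : ℝ :=
  1 + supConst x₀ (n + 2) * Real.exp
    (rateConst n T x₀ (Kf + Lf * (1 + |x₀|)) (Kg + Lg * (1 + |x₀|)) * T)

theorem IsScheme.supMoment_le_of_top [IsProbabilityMeasure P] (hB : IsFilteredBrownian B ℱ P)
    (h : IsScheme P ℱ B T f g x₀ a ⊤ N Δ ξ U L) (hΔ : 0 < Δ) (hx : x₀ ∈ domainN a ⊤ N)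
    {f' g' : ℝ → ℝ} {Lf Lg Kf Kg : ℝ≥0} (hf' : LipschitzWith Lf f') (hg' : LipschitzWith Lg g')
    (hf : Set.EqOn f f' (closure (domainN a ⊤ N))) (hg : Set.EqOn g g' (closure (domainN a ⊤ N)))
    (hKf : |f' x₀| ≤ Kf) (hKg : |g' x₀| ≤ Kg) {p : ℝ} (hp : 0 ≤ p) {n : ℕ} (hn : Even n)
    (hpn : p ≤ n) :
    supMoment P T p ξ ≤ ENNReal.ofReal (momentConst n T Lf Lg Kf Kg x₀) := by
  set τ : ℕ → ℝ≥0 := fun i => min ((i : ℝ≥0) * Δ) T with hτdef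
  have hτ : Monotone τ := fun i j hij => by
    simp only [hτdef]
    gcongr
  have hτK : τ (⌊T / Δ⌋₊ + 1) = T := min_eq_right (le_floor_succ_mul hΔ T)
  have key := lintegral_iSup_abs_pow_le_exp hB hτ (by simp [hτdef]) (T := T)
    (fun k => min_le_right _ _) (ξ := ξ)
    (fun k => (h.adapted (τ k) (min_le_right _ _)).measurable) hf'.continuous hg'.continuous
    (by positivity) (by positivity)
    (abs_le_growth_of_lipschitz hf' hKf) (abs_le_growth_of_lipschitz hg' hKg) hn
    (x₀ := x₀) (h.path_bound hΔ hx hf hg) (⌊T / Δ⌋₊ + 1)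
  rw [hτK] at key
  -- Since 0 ≤ p ≤ n + 2, one has |ξ|^p ≤ 1 + |ξ|^(n+2); this is the summand 1 in `momentConst`.
  have hpt : ∀ ω, ⨆ t ∈ Set.Iic T, ENNReal.ofReal (|ξ t ω| ^ p)
      ≤ 1 + ⨆ t ∈ Set.Iic T, ENNReal.ofReal (|ξ t ω| ^ (n + 2)) := fun ω => by
    refine iSup₂_le fun t ht => ?_
    refine le_trans ?_ (add_le_add le_rfl (le_iSup₂ (f := fun t (_ : t ∈ Set.Iic T) =>
      ENNReal.ofReal (|ξ t ω| ^ (n + 2))) t ht))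
    rw [← ENNReal.ofReal_one, ← ENNReal.ofReal_add zero_le_one (by positivity)]
    refine ENNReal.ofReal_le_ofReal ?_
    have h0 : 0 ≤ |ξ t ω| ^ (n + 2) := by positivity
    rcases le_total |ξ t ω| 1 with h1 | h1
    · linarith [Real.rpow_le_one (abs_nonneg _) h1 hp]
    · have h2 := Real.rpow_le_rpow_of_exponent_le h1 (hpn.trans
        (by push_cast; linarith : (n : ℝ) ≤ ((n + 2 : ℕ) : ℝ)))
      rw [Real.rpow_natCast] at h2
      linarith
  refine (lintegral_mono hpt).trans ?_
  have hs : 0 ≤ supConst x₀ (n + 2) := by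
    unfold supConst
    positivity
  rw [lintegral_add_left measurable_const, lintegral_const, measure_univ, mul_one, momentConst,
    ENNReal.ofReal_add zero_le_one (mul_nonneg hs (Real.exp_pos _).le), ENNReal.ofReal_one]
  exact add_le_add le_rfl key

end

end ABEP

/-! ### Extension of the coefficients and conclusion -/

theorem mainTheorem9 (p : ℝ) (hp : 2 ≤ p) (T : ℝ≥0) (hT : 0 < T)
    (Lf Lg Kf Kg : ℝ≥0) (a x₀ : ℝ) :
    ∃ C : ℝ, ∀ (Ω : Type u) (mΩ : MeasurableSpace Ω) (P : Measure Ω) (_ : IsProbabilityMeasure P)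
      (ℱ : Filtration ℝ≥0 mΩ) (_ : ABEP.UsualConditions ℱ P)
      (B : ℝ≥0 → Ω → ℝ) (_ : ABEP.IsFilteredBrownian B ℱ P)
      (b : WithTop ℝ) (_ : x₀ ∈ ABEP.domainN a b 1)
      (f g : ℝ → ℝ)
      (_ : LipschitzOnWith Lf f (ABEP.openInterval a b))
      (_ : LipschitzOnWith Lg g (ABEP.openInterval a b))
      (_ : |f x₀| ≤ Kf) (_ : |g x₀| ≤ Kg)
      (N : ℕ) (_ : 1 ≤ N) (Δ : ℝ≥0) (_ : 0 < Δ),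
      (∃ ξ U L : ℝ≥0 → Ω → ℝ, ABEP.IsScheme P ℱ B T f g x₀ a b N Δ ξ U L) ∧
      ∀ ξ U L : ℝ≥0 → Ω → ℝ, ABEP.IsScheme P ℱ B T f g x₀ a b N Δ ξ U L →
        (∀ᵐ ω ∂P, ∀ t ≤ T, ξ t ω ∈ closure (ABEP.domainN a b N)) ∧
        (∀ β : ℝ, b = (β : WithTop ℝ) →
          ABEP.supMoment P T p ξ ≤ ENNReal.ofReal (max (|a| ^ p) (|β| ^ p))) ∧
        (b = ⊤ → ABEP.supMoment P T p ξ ≤ ENNReal.ofReal C) := by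
  have hp0 : 0 ≤ p := zero_le_two.trans hp
  -- An even integer that is at least p, as the even-power moment estimate requires; C is fixed
  -- before the probability space, b, f, g, N and Δ.
  refine ⟨ABEP.momentConst (2 * ⌈p⌉₊) T Lf Lg Kf Kg x₀, ?_⟩
  intro Ω mΩ P _ ℱ hℱ B hB b hx₁ f g hf hg hKf hKg N hN Δ hΔ
  have hx := ABEP.mem_domainN_of_mem hN hx₁
  have hsub := ABEP.closure_domainN_subset hN hx
  -- The extensions keep the Lipschitz constants and agree with the coefficients on D, which
  -- contains cl D_N.
  obtain ⟨f', hf', hff'⟩ := hf.extend_real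
  obtain ⟨g', hg', hgg'⟩ := hg.extend_real
  have hxD := hsub (subset_closure hx)
  rw [hff' hxD] at hKf
  rw [hgg' hxD] at hKg
  refine ⟨ABEP.exists_isScheme hℱ hB T hf'.continuous.measurable hg'.continuous.measurable hx
    (hff'.mono hsub) (hgg'.mono hsub) hΔ, fun ξ U L h => ⟨?_, ?_, ?_⟩⟩
  · filter_upwards [h.reflected] with ω hω t ht
    exact hω.mem t ht
  · rintro β rfl
    exact h.supMoment_le_of_finite hx hp0
  · rintro rfl
    refine h.supMoment_le_of_top hB hΔ hx hf' hg' (hff'.mono hsub) (hgg'.mono hsub) hKf hKg hp0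
      (even_two_mul _) ?_
    have h1 := Nat.le_ceil p
    push_cast
    linarith [Nat.cast_nonneg (α := ℝ) ⌈p⌉₊]
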